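/- Let $p$ be a prime, $K$ a finite unramified extension of $\mathbb{Q}_p$ of degree $f$, and $E$ a finite extension of $\mathbb{Q}_p$ together with an embedding $\sigma_0:K\hookrightarrow E$. Let $\mathcal{O}_E$ be the ring of integers of $E$, $\pi$ a uniformizer, and $|\cdot|$ the absolute value of $E$ normalized by $|\pi|=p^{-1}$. Let $Y_{\sigma_0},\dots,Y_{\sigma_{f-1}}$ be variables, and for $\underline n\in\mathbb{Z}^{f-1}$ write $U^{\underline n}:=\prod_{i=1}^{f-1}(Y_{\sigma_i}/Y_{\sigma_0})^{n_i}$. Let $R$ be the $p$-adic completion of $\mathcal{O}_E[[Y_{\sigma_0}]][1/Y_{\sigma_0}]$, i.e. the ring of series $\sum_{m\in\mathbb{Z}}a_mY_{\sigma_0}^m$ with $a_m\in\mathcal{O}_E$ and $a_m\to0$ as $m\to-\infty$, with the topology in which the subgroups $\pi^kR+Y_{\sigma_0}^N\mathcal{O}_E[[Y_{\sigma_0}]]$ ($k,N\ge0$) form a basis of neighbourhoods of $0$. Put $$A_{\mathrm{mv},E}:=\Big\{\sum_{\underline n\in\mathbb{Z}^{f-1}}F_{\underline n}(Y_{\sigma_0})\,U^{\underline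 n}\;:\;F_{\underline n}\in R,\ \lim_{|\underline n|\to\infty}F_{\underline n}=0\Big\}.$$ For an integer $s\ge1$ let $A_E^{(p^{-1/s},1)}\subset R$ be the subring of series $\sum_{m\in\mathbb{Z}} a_mY_{\sigma_0}^m$ with $a_m\in\mathcal{O}_E$ and $|a_m|\,p^{-m/s}\le1$ for all $m$, endowed with the $(Y_{\sigma_0},\pi/Y_{\sigma_0}^s)$-adic topology, and let $$A_{\mathrm{mv},E}^{\dagger,s}:=\Big\{\sum_{\underline n\in\mathbb{Z}^{f-1}}F_{\underline n}(Y_{\sigma_0})\,U^{\underline n}\;:\;F_{\underline n}\in A_E^{(p^{-1/s},1)},\ \lim_{|\underline n|\to\infty}F_{\underline n}=0\Big\}\subset A_{\mathrm{mv},E},$$ $$A_{\mathrm{mv},E}^{\dagger,\infty}:=\bigcup_{s\ge1}A_{\mathrm{mv},E}^{\dagger,s},\qquad A_{\mathrm{mv},E}^{\dagger}:=A_{\mathrm{mv},E}^{\dagger,\infty}\Big[\frac1{Y_{\sigma_0}}\Big]\subset A_{\mathrm{mv},E}.$$ Then the inclusion $A_{\mathrm{mv},E}^{\dagger,\infty}\hookrightarrow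 A_{\mathrm{mv},E}$ is flat, and the inclusion $A_{\mathrm{mv},E}^{\dagger}\hookrightarrow A_{\mathrm{mv},E}$ is faithfully flat. -/

import Mathlib

namespace MvPhiGamma

open Filter Topology

set_option linter.unusedSectionVars false

section Convolution

variable {E : Type*} [NormedField E] {G : Type*} [AddCommGroup G]

/-- The Cauchy product of two families of coefficients indexed by `G`. -/
noncomputable def conv (a b : G → E) (g : G) : E := ∑' h, a h * b (g - h)

/-- Integral coefficients such that, for all `ε > 0` and `N`, only finitely many coefficients in
degrees `< N` have norm at least `ε`. -/
structure Good (deg : G →+ ℤ) (a : G → E) : Prop where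
  le_one : ∀ g, ‖a g‖ ≤ 1
  finite : ∀ ε > 0, ∀ N : ℤ, {g | deg g < N ∧ ε ≤ ‖a g‖}.Finite

variable {deg : G →+ ℤ} {a b c : G → E}

theorem Good.bddBelow (ha : Good deg a) {ε : ℝ} (hε : 0 < ε) :
    ∃ B : ℤ, ∀ g, ε ≤ ‖a g‖ → B ≤ deg g := by
  obtain ⟨B, hB⟩ := ((ha.finite ε hε 0).image deg).bddBelow
  refine ⟨min B 0, fun g hg => ?_⟩
  by_cases h : deg g < 0
  · exact (min_le_left _ _).trans (hB ⟨g, ⟨h, hg⟩, rfl⟩)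
  · exact (min_le_right _ _).trans (not_lt.1 h)

theorem norm_mul_ge {x y : E} {ε : ℝ} (hx : ‖x‖ ≤ 1) (hy : ‖y‖ ≤ 1) (h : ε ≤ ‖x * y‖) :
    ε ≤ ‖x‖ ∧ ε ≤ ‖y‖ := by
  rw [norm_mul] at h
  have := norm_nonneg x
  have := norm_nonneg y
  constructor <;> nlinarith

theorem Good.pairs (ha : Good deg a) (hb : Good deg b) {ε : ℝ} (hε : 0 < ε) (N : ℤ) :
    {u : G × G | deg u.1 + deg u.2 < N ∧ ε ≤ ‖a u.1‖ ∧ ε ≤ ‖b u.2‖}.Finite := by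
  obtain ⟨A, hA⟩ := ha.bddBelow hε
  obtain ⟨B, hB⟩ := hb.bddBelow hε
  refine ((ha.finite ε hε (N - B)).prod (hb.finite ε hε (N - A))).subset ?_
  rintro ⟨g, h⟩ ⟨h1, h2, h3⟩
  have := hA _ h2
  have := hB _ h3
  refine ⟨⟨?_, h2⟩, ⟨?_, h3⟩⟩ <;> simp only at * <;> omega

section Ultra

variable [IsUltrametricDist E]

theorem summable_of_finite [CompleteSpace E] {ι : Type*} {x : ι → E}
    (h : ∀ ε > 0, {i | ε ≤ ‖x i‖}.Finite) : Summable x := by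
  apply NonarchimedeanAddGroup.summable_of_tendsto_cofinite_zero
  rw [tendsto_zero_iff_norm_tendsto_zero, Metric.tendsto_nhds]
  intro ε hε
  refine (h ε hε).subset ?_
  intro i hi
  simpa using hi

theorem Good.conv_summable [CompleteSpace E] (ha : Good deg a) (hb : Good deg b) (g : G) :
    Summable fun h => a h * b (g - h) := by
  apply summable_of_finite
  intro ε hε
  refine ((ha.pairs hb hε (deg g + 1)).image Prod.fst).subset ?_
  intro h hh
  refine ⟨(h, g - h), ⟨?_, norm_mul_ge (ha.le_one _) (hb.le_one _) hh⟩, rfl⟩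
  simp

theorem norm_tsum_le_of {ι : Type*} {x : ι → E} {C : ℝ} (hC : 0 ≤ C) (h : ∀ i, ‖x i‖ ≤ C) :
    ‖∑' i, x i‖ ≤ C :=
  IsUltrametricDist.norm_tsum_le_of_forall_le_of_nonneg hC h

theorem Good.conv (ha : Good deg a) (hb : Good deg b) : Good deg (conv a b) where
  le_one g := norm_tsum_le_of zero_le_one fun h => by
    rw [norm_mul]; exact mul_le_one₀ (ha.le_one _) (norm_nonneg _) (hb.le_one _)
  finite ε hε N := by
    refine ((ha.pairs hb (half_pos hε) N).image fun u => u.1 + u.2).subset ?_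
    rintro g ⟨hg, hn⟩
    obtain ⟨h, hh⟩ : ∃ h, ε / 2 ≤ ‖a h * b (g - h)‖ := by
      by_contra! H
      have := norm_tsum_le_of (half_pos hε).le fun h => (H h).le
      unfold MvPhiGamma.conv at hn
      linarith
    refine ⟨(h, g - h), ⟨?_, norm_mul_ge (ha.le_one _) (hb.le_one _) hh⟩, by simp⟩
    simpa using hg

theorem Good.add (ha : Good deg a) (hb : Good deg b) : Good deg (a + b) where
  le_one g := (IsUltrametricDist.norm_add_le_max _ _).trans (max_le (ha.le_one g) (hb.le_one g))
  finite ε hε N := by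
    refine ((ha.finite ε hε N).union (hb.finite ε hε N)).subset ?_
    rintro g ⟨hg, hn⟩
    rcases le_max_iff.1 (hn.trans (IsUltrametricDist.norm_add_le_max _ _)) with h | h
    · exact Or.inl ⟨hg, h⟩
    · exact Or.inr ⟨hg, h⟩

theorem conv_add [CompleteSpace E] (ha : Good deg a) (hb : Good deg b) (hc : Good deg c) :
    conv a (b + c) = conv a b + conv a c := by
  ext g
  simp only [conv, Pi.add_apply, mul_add]
  exact (ha.conv_summable hb g).tsum_add (ha.conv_summable hc g)

theorem conv_assoc [CompleteSpace E] (ha : Good deg a) (hb : Good deg b) (hc : Good deg c) :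
    conv (conv a b) c = conv a (conv b c) := by
  ext g
  have key : Summable (Function.uncurry fun h k : G => a k * b (h - k) * c (g - h)) := by
    apply summable_of_finite
    intro ε hε
    obtain ⟨C, hC⟩ := hc.bddBelow hε
    refine ((ha.pairs hb hε (deg g - C + 1)).image fun u => (u.1 + u.2, u.1)).subset ?_
    rintro ⟨h, k⟩ hh
    have hab : ‖a k * b (h - k)‖ ≤ 1 := by
      rw [norm_mul]; exact mul_le_one₀ (ha.le_one _) (norm_nonneg _) (hb.le_one _)
    obtain ⟨h1, h2⟩ := norm_mul_ge hab (hc.le_one (g - h)) hh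
    refine ⟨(k, h - k), ⟨?_, norm_mul_ge (ha.le_one _) (hb.le_one _) h1⟩, by simp⟩
    have := hC _ h2
    simp only [map_sub] at *
    omega
  have e1 : conv (conv a b) c g = ∑' h, ∑' k, a k * b (h - k) * c (g - h) := by
    simp only [conv, tsum_mul_right]
  have e2 : conv a (conv b c) g = ∑' k, ∑' h, a k * b (h - k) * c (g - h) := by
    simp only [conv, ← tsum_mul_left]
    refine tsum_congr fun k => ?_
    rw [← (Equiv.subRight k).tsum_eq]
    refine tsum_congr fun h => ?_
    simp [mul_assoc]
  rw [e1, e2]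
  exact key.tsum_comm.symm

end Ultra

theorem Good.neg (ha : Good deg a) : Good deg (-a) where
  le_one g := by simpa using ha.le_one g
  finite ε hε N := by simpa using ha.finite ε hε N

theorem Good.single [DecidableEq G] (u : G) {x : E} (hx : ‖x‖ ≤ 1) :
    Good deg (Pi.single u x) where
  le_one g := by
    by_cases h : g = u
    · subst h; simpa using hx
    · simp [h]
  finite ε hε N := by
    refine (Set.finite_singleton u).subset ?_
    rintro g ⟨-, hg⟩
    by_contra h
    rw [Pi.single_eq_of_ne h, norm_zero] at hg
    linarith

theorem Good.zero : Good deg (0 : G → E) where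
  le_one g := by simp
  finite ε hε N := by
    convert Set.finite_empty
    ext g
    simp [hε]

theorem conv_comm (a b : G → E) : conv a b = conv b a := by
  ext g
  rw [conv, ← (Equiv.subLeft g).tsum_eq]
  simp [conv, mul_comm]

theorem single_conv [DecidableEq G] (u : G) (x : E) (b : G → E) (g : G) :
    conv (Pi.single u x) b g = x * b (g - u) := by
  rw [conv, tsum_eq_single u]
  · simp
  · intro h hh
    simp [hh]

theorem one_conv [DecidableEq G] (b : G → E) : conv (Pi.single 0 1) b = b := by
  ext g
  simp [single_conv]

theorem zero_conv (b : G → E) : conv 0 b = 0 := by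
  ext g
  simp [conv]

end Convolution

section LocalField

theorem isUltrametricDist (p : ℕ) [Fact p.Prime] (E : Type*) [NormedField E]
    [NormedAlgebra ℚ_[p] E] : IsUltrametricDist E :=
  IsUltrametricDist.of_normedAlgebra ℚ_[p]

theorem completeSpace (p : ℕ) [Fact p.Prime] (E : Type*) [NormedField E]
    [NormedAlgebra ℚ_[p] E] [FiniteDimensional ℚ_[p] E] : CompleteSpace E :=
  FiniteDimensional.complete ℚ_[p] E

end LocalField

/-- The `p`-adic completion of `O_E[[Y]][1/Y]`, where `O_E = {x ∈ E | ‖x‖ ≤ 1}`: the ring of series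
`∑_{m ∈ ℤ} a_m Y^m` with `a_m ∈ O_E` and `a_m → 0` as `m → -∞`. -/
@[ext]
structure LaurentHat (p : ℕ) (E : Type*) [NormedField E] where
  coeff : ℤ → E
  norm_coeff_le : ∀ m, ‖coeff m‖ ≤ 1
  tendsto_coeff : Tendsto coeff atBot (𝓝 0)

/-- A family of series in `LaurentHat p E` tends to zero (along the cofinite filter) for the
`(π, Y)`-adic topology, that is the topology in which the subgroups
`π ^ k • LaurentHat p E + Y ^ N • O_E[[Y]]` form a basis of neighbourhoods of zero. -/
def TendstoZero {p : ℕ} {E : Type*} [NormedField E] {L : Type*} (F : L → LaurentHat p E) : Prop :=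
  ∀ ε > 0, ∀ N : ℤ, ∀ᶠ n in cofinite, ∀ m < N, ‖(F n).coeff m‖ < ε

/-- The ring `A_{mv,E}` in `f` variables: series `∑_{n ∈ ℤ^{f-1}} F_n(Y_0) ∏_i (Y_i/Y_0)^{n_i}` with
coefficients `F_n` in `LaurentHat p E` tending to zero. -/
@[ext]
structure Amv (p : ℕ) (E : Type*) [NormedField E] (f : ℕ) where
  coeff : (Fin (f - 1) → ℤ) → LaurentHat p E
  tendsto_coeff : TendstoZero coeff

section Rings

variable {p : ℕ} {E : Type*} [NormedField E]

theorem LaurentHat.good (a : LaurentHat p E) : Good (AddMonoidHom.id ℤ) a.coeff where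
  le_one := a.norm_coeff_le
  finite ε hε N := by
    have h := Metric.tendsto_nhds.1 a.tendsto_coeff ε hε
    obtain ⟨B, hB⟩ := eventually_atBot.1 h
    refine (Set.finite_Ico B N).subset ?_
    rintro m ⟨hm, hn⟩
    refine ⟨?_, hm⟩
    by_contra H
    have := hB m (not_le.1 H).le
    rw [dist_zero_right] at this
    linarith

/-- The series with given good coefficients. -/
def LaurentHat.mk' (a : ℤ → E) (ha : Good (AddMonoidHom.id ℤ) a) : LaurentHat p E where
  coeff := a
  norm_coeff_le := ha.le_one
  tendsto_coeff := by
    rw [Metric.tendsto_nhds]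
    intro ε hε
    obtain ⟨B, hB⟩ := ha.bddBelow hε
    refine eventually_atBot.2 ⟨B - 1, fun m hm => ?_⟩
    rw [dist_zero_right]
    by_contra! H
    have := hB m H
    simp at this
    omega

/-- The degree in `Y_0`. -/
def degY (L : Type*) [AddCommGroup L] : L × ℤ →+ ℤ := AddMonoidHom.snd L ℤ

/-- All coefficients of an element of `A_{mv,E}`. -/
def Amv.fn {f : ℕ} (a : Amv p E f) (u : (Fin (f - 1) → ℤ) × ℤ) : E := (a.coeff u.1).coeff u.2

theorem Amv.fn_injective {f : ℕ} : Function.Injective (Amv.fn : Amv p E f → _) := by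
  intro a b h
  ext n m
  exact congrFun h (n, m)

theorem Amv.good {f : ℕ} (a : Amv p E f) : Good (degY _) a.fn where
  le_one g := (a.coeff g.1).norm_coeff_le _
  finite ε hε N := by
    have h1 : {n | ¬ ∀ m < N, ‖(a.coeff n).coeff m‖ < ε}.Finite := a.tendsto_coeff ε hε N
    refine (h1.biUnion fun n _ =>
      ((a.coeff n).good.finite ε hε N).image fun m => (n, m)).subset ?_
    rintro ⟨n, m⟩ ⟨hm, hn⟩
    simp only [Set.mem_iUnion]
    refine ⟨n, fun H => ?_, m, ⟨hm, hn⟩, rfl⟩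
    exact absurd (H m hm) (not_lt.2 hn)

/-- The element of `A_{mv,E}` with given good coefficients. -/
def Amv.mk' {f : ℕ} (a : (Fin (f - 1) → ℤ) × ℤ → E) (ha : Good (degY _) a) : Amv p E f where
  coeff n := LaurentHat.mk' (fun m => a (n, m))
    { le_one := fun m => ha.le_one (n, m)
      finite := fun ε hε N =>
        (ha.finite ε hε N).preimage ((Prod.mk_right_injective n).injOn) }
  tendsto_coeff ε hε N := by
    refine ((ha.finite ε hε N).image Prod.fst).subset ?_
    intro n hn
    simp only [Set.mem_compl_iff, Set.mem_ofPred_eq, not_forall, not_lt] at hn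
    obtain ⟨m, hm, h⟩ := hn
    exact ⟨(n, m), ⟨hm, h⟩, rfl⟩

@[simp]
theorem LaurentHat.coeff_mk' (a : ℤ → E) (ha : Good (AddMonoidHom.id ℤ) a) :
    (LaurentHat.mk' a ha : LaurentHat p E).coeff = a := rfl

@[simp]
theorem Amv.fn_mk' {f : ℕ} (a : (Fin (f - 1) → ℤ) × ℤ → E) (ha : Good (degY _) a) :
    (Amv.mk' a ha : Amv p E f).fn = a := rfl

variable [Fact p.Prime] [NormedAlgebra ℚ_[p] E] [FiniteDimensional ℚ_[p] E]

noncomputable instance : Zero (LaurentHat p E) := ⟨.mk' 0 Good.zero⟩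

noncomputable instance : One (LaurentHat p E) :=
  ⟨.mk' (Pi.single 0 1) (Good.single 0 (by simp))⟩

noncomputable instance : Neg (LaurentHat p E) := ⟨fun a => .mk' (-a.coeff) a.good.neg⟩

/-- Coefficientwise addition. -/
noncomputable instance : Add (LaurentHat p E) :=
  haveI := isUltrametricDist p E
  ⟨fun a b => .mk' (a.coeff + b.coeff) (a.good.add b.good)⟩

/-- The Cauchy product. -/
noncomputable instance : Mul (LaurentHat p E) :=
  haveI := isUltrametricDist p E
  ⟨fun a b => .mk' (conv a.coeff b.coeff) (a.good.conv b.good)⟩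

noncomputable instance : CommRing (LaurentHat p E) :=
  haveI := isUltrametricDist p E
  haveI := completeSpace p E
  { nsmul := nsmulRec
    zsmul := zsmulRec
    add_assoc := fun a b c => LaurentHat.ext (add_assoc a.coeff b.coeff c.coeff)
    zero_add := fun a => LaurentHat.ext (zero_add a.coeff)
    add_zero := fun a => LaurentHat.ext (add_zero a.coeff)
    add_comm := fun a b => LaurentHat.ext (add_comm a.coeff b.coeff)
    neg_add_cancel := fun a => LaurentHat.ext (neg_add_cancel a.coeff)
    mul_assoc := fun a b c => LaurentHat.ext (conv_assoc a.good b.good c.good)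
    mul_comm := fun a b => LaurentHat.ext (conv_comm _ _)
    one_mul := fun a => LaurentHat.ext (one_conv _)
    mul_one := fun a => LaurentHat.ext ((conv_comm _ _).trans (one_conv _))
    zero_mul := fun a => LaurentHat.ext (zero_conv _)
    mul_zero := fun a => LaurentHat.ext ((conv_comm _ _).trans (zero_conv _))
    left_distrib := fun a b c => LaurentHat.ext (conv_add a.good b.good c.good)
    right_distrib := fun a b c => LaurentHat.ext <|
      (conv_comm _ _).trans <| (conv_add c.good a.good b.good).trans <|
        congrArg₂ (· + ·) (conv_comm _ _) (conv_comm _ _) }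

@[simp] theorem LaurentHat.coeff_zero : (0 : LaurentHat p E).coeff = 0 := rfl
@[simp] theorem LaurentHat.coeff_one : (1 : LaurentHat p E).coeff = Pi.single 0 1 := rfl
@[simp] theorem LaurentHat.coeff_add (a b : LaurentHat p E) :
    (a + b).coeff = a.coeff + b.coeff := rfl
@[simp] theorem LaurentHat.coeff_neg (a : LaurentHat p E) : (-a).coeff = -a.coeff := rfl
@[simp] theorem LaurentHat.coeff_mul (a b : LaurentHat p E) :
    (a * b).coeff = conv a.coeff b.coeff := rfl

noncomputable instance {f : ℕ} : Zero (Amv p E f) := ⟨.mk' 0 Good.zero⟩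

noncomputable instance {f : ℕ} : One (Amv p E f) :=
  ⟨.mk' (Pi.single 0 1) (Good.single 0 (by simp))⟩

noncomputable instance {f : ℕ} : Neg (Amv p E f) := ⟨fun a => .mk' (-a.fn) a.good.neg⟩

/-- Coefficientwise addition. -/
noncomputable instance {f : ℕ} : Add (Amv p E f) :=
  haveI := isUltrametricDist p E
  ⟨fun a b => .mk' (a.fn + b.fn) (a.good.add b.good)⟩

/-- The Cauchy product. -/
noncomputable instance {f : ℕ} : Mul (Amv p E f) :=
  haveI := isUltrametricDist p E
  ⟨fun a b => .mk' (conv a.fn b.fn) (a.good.conv b.good)⟩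

noncomputable instance {f : ℕ} : CommRing (Amv p E f) :=
  haveI := isUltrametricDist p E
  haveI := completeSpace p E
  { nsmul := nsmulRec
    zsmul := zsmulRec
    add_assoc := fun a b c => Amv.fn_injective (add_assoc a.fn b.fn c.fn)
    zero_add := fun a => Amv.fn_injective (zero_add a.fn)
    add_zero := fun a => Amv.fn_injective (add_zero a.fn)
    add_comm := fun a b => Amv.fn_injective (add_comm a.fn b.fn)
    neg_add_cancel := fun a => Amv.fn_injective (neg_add_cancel a.fn)
    mul_assoc := fun a b c => Amv.fn_injective (conv_assoc a.good b.good c.good)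
    mul_comm := fun a b => Amv.fn_injective (conv_comm _ _)
    one_mul := fun a => Amv.fn_injective (one_conv _)
    mul_one := fun a => Amv.fn_injective ((conv_comm _ _).trans (one_conv _))
    zero_mul := fun a => Amv.fn_injective (zero_conv _)
    mul_zero := fun a => Amv.fn_injective ((conv_comm _ _).trans (zero_conv _))
    left_distrib := fun a b c => Amv.fn_injective (conv_add a.good b.good c.good)
    right_distrib := fun a b c => Amv.fn_injective <|
      (conv_comm _ _).trans <| (conv_add c.good a.good b.good).trans <|
        congrArg₂ (· + ·) (conv_comm _ _) (conv_comm _ _) }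

variable {f : ℕ}

@[simp] theorem Amv.fn_zero : (0 : Amv p E f).fn = 0 := rfl
@[simp] theorem Amv.fn_one : (1 : Amv p E f).fn = Pi.single 0 1 := rfl
@[simp] theorem Amv.fn_add (a b : Amv p E f) : (a + b).fn = a.fn + b.fn := rfl
@[simp] theorem Amv.fn_neg (a : Amv p E f) : (-a).fn = -a.fn := rfl
@[simp] theorem Amv.fn_mul (a b : Amv p E f) : (a * b).fn = conv a.fn b.fn := rfl

end Rings

section Uniformizer

variable {E : Type*} [NormedField E]

/-- `ϖ` generates the maximal ideal `{‖x‖ < 1}` of the ring of integers `{‖x‖ ≤ 1}` of `E`. -/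
def IsUniformizer (ϖ : E) : Prop :=
  ϖ ≠ 0 ∧ ∀ x : E, ‖x‖ < 1 ↔ ∃ y : E, ‖y‖ ≤ 1 ∧ x = ϖ * y

/-- The power of the absolute value of `E` which is normalized by `|ϖ| = p⁻¹`. -/
noncomputable def normalizedNorm (p : ℕ) (ϖ x : E) : ℝ :=
  ‖x‖ ^ (-Real.log p / Real.log ‖ϖ‖)

variable {ϖ : E}

theorem IsUniformizer.norm_pos (hϖ : IsUniformizer ϖ) : 0 < ‖ϖ‖ := norm_pos_iff.2 hϖ.1

theorem IsUniformizer.norm_lt_one (hϖ : IsUniformizer ϖ) : ‖ϖ‖ < 1 :=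
  (hϖ.2 ϖ).2 ⟨1, by simp, by simp⟩

theorem IsUniformizer.exists_norm_eq (hϖ : IsUniformizer ϖ) {x : E} (hx : x ≠ 0) (h1 : ‖x‖ ≤ 1) :
    ∃ v : ℕ, ‖x‖ = ‖ϖ‖ ^ v := by
  obtain ⟨v, hv, hv'⟩ := exists_nat_pow_near_of_lt_one (norm_pos_iff.2 hx) h1 hϖ.norm_pos
    hϖ.norm_lt_one
  refine ⟨v, le_antisymm hv' (not_lt.1 fun hlt => ?_)⟩
  have hp : 0 < ‖ϖ‖ ^ v := pow_pos hϖ.norm_pos v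
  obtain ⟨y, hy, hxy⟩ := (hϖ.2 (x / ϖ ^ v)).1 (by rw [norm_div, norm_pow, div_lt_one hp]; exact hlt)
  have : x = ϖ ^ (v + 1) * y := by
    rw [div_eq_iff (pow_ne_zero _ hϖ.1)] at hxy
    rw [hxy]; ring
  rw [this, norm_mul, norm_pow] at hv
  have := pow_pos hϖ.norm_pos (v + 1)
  nlinarith

section

variable {p : ℕ} [hp : Fact p.Prime]

theorem IsUniformizer.exponent_pos (hϖ : IsUniformizer ϖ) :
    0 < -Real.log p / Real.log ‖ϖ‖ := by
  have h1 : Real.log ‖ϖ‖ < 0 := Real.log_neg hϖ.norm_pos hϖ.norm_lt_one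
  have h2 : 0 < Real.log p := Real.log_pos (by exact_mod_cast hp.out.one_lt)
  exact div_pos_of_neg_of_neg (by linarith) h1

theorem IsUniformizer.rpow_eq (hϖ : IsUniformizer ϖ) (v : ℕ) :
    (‖ϖ‖ ^ v) ^ (-Real.log p / Real.log ‖ϖ‖) = (p : ℝ) ^ (-(v : ℝ)) := by
  have h1 : Real.log ‖ϖ‖ < 0 := Real.log_neg hϖ.norm_pos hϖ.norm_lt_one
  have h0 : (0 : ℝ) < p := by exact_mod_cast hp.out.pos
  rw [Real.rpow_def_of_pos (pow_pos hϖ.norm_pos v), Real.rpow_def_of_pos h0, Real.log_pow]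
  have h2 := h1.ne
  congr 1
  field_simp

theorem normalizedNorm_nonneg (x : E) : 0 ≤ normalizedNorm p ϖ x :=
  Real.rpow_nonneg (norm_nonneg x) _

theorem normalizedNorm_mul (x y : E) :
    normalizedNorm p ϖ (x * y) = normalizedNorm p ϖ x * normalizedNorm p ϖ y := by
  simp only [normalizedNorm, norm_mul]
  exact Real.mul_rpow (norm_nonneg x) (norm_nonneg y)

theorem normalizedNorm_one : normalizedNorm p ϖ (1 : E) = 1 := by
  simp [normalizedNorm]

theorem IsUniformizer.normalizedNorm_zero (hϖ : IsUniformizer ϖ) :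
    normalizedNorm p ϖ (0 : E) = 0 := by
  rw [normalizedNorm, norm_zero, Real.zero_rpow (hϖ.exponent_pos (p := p)).ne']

theorem IsUniformizer.normalizedNorm_le_iff (hϖ : IsUniformizer ϖ) (x : E) {C : ℝ} (hC : 0 ≤ C) :
    normalizedNorm p ϖ x ≤ C ↔ ‖x‖ ≤ C ^ (-Real.log p / Real.log ‖ϖ‖)⁻¹ :=
  (Real.le_rpow_inv_iff_of_pos (norm_nonneg x) hC hϖ.exponent_pos).symm

theorem IsUniformizer.normalizedNorm_self (hϖ : IsUniformizer ϖ) :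
    normalizedNorm p ϖ ϖ = (p : ℝ)⁻¹ := by
  have := hϖ.rpow_eq (p := p) 1
  rw [pow_one] at this
  rw [normalizedNorm, this, Nat.cast_one, Real.rpow_neg_one]

/-- The radius `p ^ (-1 / s)`. -/
noncomputable def radius (p : ℕ) (s : ℕ+) : ℝ := (p : ℝ) ^ (-(1 / (s : ℝ)))

theorem radius_pos (s : ℕ+) : 0 < radius p s :=
  Real.rpow_pos_of_pos (by exact_mod_cast hp.out.pos) _

/-- The monomial `x Y ^ m` has order at least `k` for the ideal `(Y, ϖ / Y ^ s)`. -/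
def Ord (ϖ : E) (s : ℕ+) (k : ℕ) (m : ℤ) (x : E) : Prop :=
  ∃ v : ℕ, ‖x‖ ≤ ‖ϖ‖ ^ v ∧ 0 ≤ m + s * v ∧ (k : ℤ) ≤ v + (m + s * v)

theorem Ord.zero (s : ℕ+) (k : ℕ) (m : ℤ) : Ord ϖ s k m (0 : E) := by
  have hs : (1 : ℤ) ≤ (s : ℕ) := by exact_mod_cast s.pos
  have := abs_nonneg m
  have := neg_abs_le m
  refine ⟨m.natAbs + k, ?_, ?_, ?_⟩
  · rw [norm_zero]; positivity
  · push_cast; nlinarith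
  · push_cast; nlinarith

theorem Ord.mono {s : ℕ+} {k k' : ℕ} (h : k' ≤ k) {m : ℤ} {x : E} (hx : Ord ϖ s k m x) :
    Ord ϖ s k' m x := by
  obtain ⟨v, h1, h2, h3⟩ := hx
  exact ⟨v, h1, h2, by omega⟩

theorem Ord.mul {s : ℕ+} {k k' : ℕ} {m m' : ℤ} {x x' : E} (hx : Ord ϖ s k m x)
    (hx' : Ord ϖ s k' m' x') : Ord ϖ s (k + k') (m + m') (x * x') := by
  obtain ⟨v, h1, h2, h3⟩ := hx
  obtain ⟨v', h1', h2', h3'⟩ := hx'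
  refine ⟨v + v', ?_, ?_, ?_⟩
  · rw [norm_mul, pow_add]
    exact mul_le_mul h1 h1' (norm_nonneg _) (by positivity)
  · push_cast; linarith
  · push_cast; linarith

theorem Ord.exists_bound (hϖ : IsUniformizer ϖ) (s : ℕ+) (k : ℕ) (m : ℤ) :
    ∃ w : ℕ, ∀ x : E, Ord ϖ s k m x ↔ ‖x‖ ≤ ‖ϖ‖ ^ w := by
  classical
  have hex : ∃ v : ℕ, 0 ≤ m + s * v ∧ (k : ℤ) ≤ v + (m + s * v) := by
    obtain ⟨v, -, h⟩ := Ord.zero (ϖ := ϖ) s k m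
    exact ⟨v, h⟩
  refine ⟨Nat.find hex, fun x => ⟨?_, fun h => ⟨_, h, Nat.find_spec hex⟩⟩⟩
  rintro ⟨v, h1, h2⟩
  exact h1.trans (pow_le_pow_of_le_one hϖ.norm_pos.le hϖ.norm_lt_one.le (Nat.find_min' hex h2))

theorem Ord.tsum [IsUltrametricDist E] (hϖ : IsUniformizer ϖ) {s : ℕ+} {k : ℕ} {m : ℤ}
    {ι : Type*} {x : ι → E} (hx : ∀ i, Ord ϖ s k m (x i)) : Ord ϖ s k m (∑' i, x i) := by
  obtain ⟨w, hw⟩ := Ord.exists_bound hϖ s k m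
  rw [hw]
  exact norm_tsum_le_of (by positivity) fun i => (hw _).1 (hx i)

theorem Ord.add [IsUltrametricDist E] (hϖ : IsUniformizer ϖ) {s : ℕ+} {k : ℕ} {m : ℤ}
    {x y : E} (hx : Ord ϖ s k m x) (hy : Ord ϖ s k m y) : Ord ϖ s k m (x + y) := by
  obtain ⟨w, hw⟩ := Ord.exists_bound hϖ s k m
  rw [hw] at *
  exact (IsUltrametricDist.norm_add_le_max _ _).trans (max_le hx hy)

theorem Ord.neg {s : ℕ+} {k : ℕ} {m : ℤ} {x : E} (hx : Ord ϖ s k m x) : Ord ϖ s k m (-x) := by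
  obtain ⟨v, h⟩ := hx
  exact ⟨v, by rwa [norm_neg]⟩

theorem IsUniformizer.ord_zero_iff (hϖ : IsUniformizer ϖ) (s : ℕ+) (m : ℤ) {x : E}
    (hx : ‖x‖ ≤ 1) : normalizedNorm p ϖ x * radius p s ^ m ≤ 1 ↔ Ord ϖ s 0 m x := by
  have hp1 : (1 : ℝ) < p := by exact_mod_cast hp.out.one_lt
  have hp0 : (0 : ℝ) < p := by linarith
  have hs : (0 : ℝ) < (s : ℕ) := by exact_mod_cast s.pos
  have key : ∀ v : ℕ, (p : ℝ) ^ (-(v : ℝ)) * radius p s ^ m ≤ 1 ↔ 0 ≤ m + (s : ℕ) * (v : ℤ) := by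
    intro v
    rw [radius, ← Real.rpow_intCast, ← Real.rpow_mul hp0.le, ← Real.rpow_add hp0]
    have h0 := Real.rpow_le_rpow_left_iff (y := -(v : ℝ) + -(1 / ((s : ℕ) : ℝ)) * m) (z := 0) hp1
    rw [Real.rpow_zero] at h0
    rw [h0]
    have e : -(v : ℝ) + -(1 / ((s : ℕ) : ℝ)) * m = -((m + (s : ℕ) * v) / (s : ℕ)) := by
      field_simp
      ring
    rw [e, neg_nonpos, le_div_iff₀ hs, zero_mul]
    exact_mod_cast Iff.rfl
  constructor
  · intro h
    by_cases hx0 : x = 0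
    · subst hx0; exact Ord.zero s 0 m
    obtain ⟨v, hv⟩ := hϖ.exists_norm_eq hx0 hx
    rw [normalizedNorm, hv, hϖ.rpow_eq, key] at h
    refine ⟨v, hv.le, h, ?_⟩
    push_cast
    omega
  · rintro ⟨v, h1, h2, -⟩
    refine le_trans (mul_le_mul_of_nonneg_right ?_ (zpow_nonneg (radius_pos s).le m)) ((key v).2 h2)
    rw [← hϖ.rpow_eq]
    exact Real.rpow_le_rpow (norm_nonneg x) h1 hϖ.exponent_pos.le

end

end Uniformizer

section Dagger

variable (p : ℕ) [Fact p.Prime] {E : Type*} [NormedField E] [NormedAlgebra ℚ_[p] E]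
  [FiniteDimensional ℚ_[p] E] {ϖ : E} (hϖ : IsUniformizer ϖ)

/-- The ring `A_E^{(ρ,1)}` of series `∑ a_m Y^m` with `a_m ∈ O_E` and `|a_m| ρ ^ m ≤ 1` for all
`m ∈ ℤ`, as a subring of `LaurentHat p E`. -/
def annulusRing (ρ : ℝ) (hρ : 0 < ρ) : Subring (LaurentHat p E) where
  carrier := {a | ∀ m : ℤ, normalizedNorm p ϖ (a.coeff m) * ρ ^ m ≤ 1}
  zero_mem' m := by simp [hϖ.normalizedNorm_zero]
  one_mem' m := by
    by_cases h : m = 0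
    · subst h; simp [normalizedNorm_one]
    · simp [h, hϖ.normalizedNorm_zero]
  neg_mem' {a} ha m := by simpa [normalizedNorm] using ha m
  add_mem' {a b} ha hb m := by
    have := isUltrametricDist p E
    have hm := zpow_pos hρ m
    have ha := ha m
    have hb := hb m
    rw [← le_div_iff₀ hm, hϖ.normalizedNorm_le_iff _ (by positivity)] at *
    exact (IsUltrametricDist.norm_add_le_max _ _).trans (max_le ha hb)
  mul_mem' {a b} ha hb m := by
    have := isUltrametricDist p E
    have hm := zpow_pos hρ m
    rw [← le_div_iff₀ hm, hϖ.normalizedNorm_le_iff _ (by positivity)]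
    refine norm_tsum_le_of (by positivity) fun h => ?_
    rw [← hϖ.normalizedNorm_le_iff (p := p) _ (by positivity), le_div_iff₀ hm, normalizedNorm_mul]
    have e : ρ ^ m = ρ ^ h * ρ ^ (m - h) := by rw [← zpow_add₀ hρ.ne']; congr 1; ring
    rw [e, mul_mul_mul_comm]
    exact mul_le_one₀ (ha h) (mul_nonneg (normalizedNorm_nonneg _) (zpow_nonneg hρ.le _))
      (hb (m - h))

/-- The ring `A_E^{(p^{-1/s},1)}`. -/
noncomputable abbrev annulus (s : ℕ+) : Subring (LaurentHat p E) :=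
  annulusRing p hϖ (radius p s) (radius_pos s)

/-- The monomial `c Y ^ m`. -/
noncomputable def monomial (m : ℤ) (c : E) (hc : ‖c‖ ≤ 1) : LaurentHat p E :=
  .mk' (Pi.single m c) (Good.single m hc)

theorem mem_annulus_iff {s : ℕ+} {a : LaurentHat p E} :
    a ∈ annulus p hϖ s ↔ ∀ m, Ord ϖ s 0 m (a.coeff m) :=
  forall_congr' fun m => hϖ.ord_zero_iff s m (a.norm_coeff_le m)

theorem monomial_mem {s : ℕ+} {m : ℤ} {c : E} (hc : ‖c‖ ≤ 1) {k : ℕ} (h : Ord ϖ s k m c) (i : ℤ) :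
    Ord ϖ s k i ((monomial p m c hc).coeff i) := by
  by_cases hi : i = m
  · subst hi; simpa [monomial] using h
  · simpa [monomial, hi] using Ord.zero s k i

theorem ord_Y (s : ℕ+) : Ord ϖ s 1 1 (1 : E) := ⟨0, by simp⟩

theorem ord_X (s : ℕ+) : Ord ϖ s 1 (-(s : ℤ)) ϖ := ⟨1, by simp⟩

/-- The element `Y` of `A_E^{(p^{-1/s},1)}`. -/
noncomputable def annulusY (s : ℕ+) : annulus p hϖ s :=
  ⟨monomial p 1 1 (by simp), (mem_annulus_iff p hϖ).2 fun i =>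
    monomial_mem p _ ((ord_Y s).mono zero_le_one) i⟩

/-- The element `ϖ / Y ^ s` of `A_E^{(p^{-1/s},1)}`. -/
noncomputable def annulusX (s : ℕ+) : annulus p hϖ s :=
  ⟨monomial p (-(s : ℤ)) ϖ hϖ.norm_lt_one.le, (mem_annulus_iff p hϖ).2 fun i =>
    monomial_mem p _ ((ord_X s).mono zero_le_one) i⟩

/-- The ideal `(Y, ϖ / Y ^ s)` of `A_E^{(p^{-1/s},1)}`. -/
noncomputable def annulusIdeal (s : ℕ+) : Ideal (annulus p hϖ s) :=
  Ideal.span {annulusY p hϖ s, annulusX p hϖ s}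

theorem conv_ord [IsUltrametricDist E] (hϖ : IsUniformizer ϖ) {s : ℕ+} {k k' : ℕ} {a b : ℤ → E} (ha : ∀ m, Ord ϖ s k m (a m))
    (hb : ∀ m, Ord ϖ s k' m (b m)) (m : ℤ) : Ord ϖ s (k + k') m (conv a b m) := by
  refine Ord.tsum hϖ fun h => ?_
  simpa using (ha h).mul (hb (m - h))

/-- The ideal of elements of order at least `k`. -/
def ordIdeal (s : ℕ+) (k : ℕ) : Ideal (annulus p hϖ s) where
  carrier := {a | ∀ m, Ord ϖ s k m (a.1.coeff m)}
  zero_mem' m := Ord.zero s k m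
  add_mem' {a b} ha hb m := by
    have := isUltrametricDist p E
    exact (ha m).add hϖ (hb m)
  smul_mem' c a ha m := by
    have := isUltrametricDist p E
    have h := conv_ord hϖ ((mem_annulus_iff p hϖ).1 c.2) ha m
    rw [zero_add] at h
    exact h

theorem exists_of_ord (hϖ : IsUniformizer ϖ) {s : ℕ+} {k : ℕ} {x : ℤ → E} (hx : ∀ m, Ord ϖ s k m (x m)) :
    ∃ y : ordIdeal p hϖ s k, y.1.1.coeff = x := by
  have h1 : ∀ m, ‖x m‖ ≤ 1 := fun m => by
    obtain ⟨v, hv, -⟩ := hx m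
    exact hv.trans (pow_le_one₀ (norm_nonneg _) hϖ.norm_lt_one.le)
  have h2 : Tendsto x atBot (𝓝 0) := by
    rw [Metric.tendsto_nhds]
    intro ε hε
    obtain ⟨n, hn⟩ := exists_pow_lt_of_lt_one hε hϖ.norm_lt_one
    refine eventually_atBot.2 ⟨-((s : ℕ) * n : ℤ), fun m hm => ?_⟩
    rw [dist_zero_right]
    obtain ⟨v, hv, hv', -⟩ := hx m
    refine (hv.trans (pow_le_pow_of_le_one hϖ.norm_pos.le hϖ.norm_lt_one.le ?_)).trans_lt hn
    have hs : (1 : ℤ) ≤ (s : ℕ) := by exact_mod_cast s.pos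
    have : (n : ℤ) ≤ v := by nlinarith
    exact_mod_cast this
  exact ⟨⟨⟨⟨x, h1, h2⟩, (mem_annulus_iff p hϖ).2 fun m => (hx m).mono ((Nat.zero_le k))⟩, hx⟩, rfl⟩

theorem annulusIdeal_pow (s : ℕ+) (k : ℕ) : annulusIdeal p hϖ s ^ k = ordIdeal p hϖ s k := by
  induction k with
  | zero =>
    rw [pow_zero, Ideal.one_eq_top]
    symm
    rw [Ideal.eq_top_iff_one]
    exact (mem_annulus_iff p hϖ).1 (1 : annulus p hϖ s).2
  | succ k ih =>
    have := isUltrametricDist p E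
    rw [pow_succ, ih]
    apply le_antisymm
    · rw [Ideal.mul_le]
      intro a ha b hb
      have hb' : b ∈ ordIdeal p hϖ s 1 := by
        refine Ideal.span_le.2 ?_ hb
        rintro c (rfl | rfl)
        · exact fun i => monomial_mem p (by simp) (ord_Y s) i
        · exact fun i => monomial_mem p hϖ.norm_lt_one.le (ord_X s) i
      exact fun m => conv_ord hϖ ha hb' m
    · intro a ha
      classical
      have hs : (1 : ℤ) ≤ (s : ℕ) := by exact_mod_cast s.pos
      choose v h1 h2 h3 using ha
      obtain ⟨y, hy⟩ := exists_of_ord p hϖ (s := s) (k := k)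
        (x := fun m => if 1 ≤ m + 1 + s * v (m + 1) then a.1.coeff (m + 1) else 0) (by
          intro m
          split_ifs with h
          · refine ⟨v (m + 1), h1 _, by omega, ?_⟩
            have := h3 (m + 1)
            push_cast at this
            omega
          · exact Ord.zero s k m)
      obtain ⟨z, hz⟩ := exists_of_ord p hϖ (s := s) (k := k)
        (x := fun m => if 1 ≤ m - s + s * v (m - s) then 0 else a.1.coeff (m - s) / ϖ) (by
          intro m
          split_ifs with h
          · exact Ord.zero s k m
          · have a2 := h2 (m - s)
            have a3 := h3 (m - s)
            have e : m - s + (s : ℕ) * (v (m - s) : ℤ) = 0 := by omega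
            rw [e] at a3
            obtain ⟨w, hw⟩ : ∃ w, v (m - s) = w + 1 := by
              refine ⟨v (m - s) - 1, ?_⟩
              push_cast at a3
              omega
            have hn := h1 (m - s)
            rw [hw] at a3 e hn
            push_cast at e a3
            have e' : m + (s : ℕ) * (w : ℤ) = 0 := by linarith
            refine ⟨w, ?_, e'.ge, by omega⟩
            rw [norm_div, div_le_iff₀ hϖ.norm_pos, ← pow_succ]
            exact hn)
      have : a = y.1 * annulusY p hϖ s + z.1 * annulusX p hϖ s := by
        apply Subtype.ext
        apply LaurentHat.ext
        ext m
        have e1 : (y.1 * annulusY p hϖ s : annulus p hϖ s).1.coeff m = y.1.1.coeff (m - 1) := by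
          change conv y.1.1.coeff (Pi.single 1 1) m = _
          rw [conv_comm, single_conv, one_mul]
        have e2 : (z.1 * annulusX p hϖ s : annulus p hϖ s).1.coeff m =
            ϖ * z.1.1.coeff (m + s) := by
          change conv z.1.1.coeff (Pi.single (-(s : ℤ)) ϖ) m = _
          rw [conv_comm, single_conv, sub_neg_eq_add]
        change a.1.coeff m = (y.1 * annulusY p hϖ s : annulus p hϖ s).1.coeff m +
          (z.1 * annulusX p hϖ s : annulus p hϖ s).1.coeff m
        rw [e1, e2, hy, hz]
        simp only [sub_add_cancel, add_sub_cancel_right]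
        split_ifs with h
        · simp
        · rw [zero_add, mul_div_cancel₀ _ hϖ.1]
      rw [this]
      exact add_mem
        (Ideal.mul_mem_mul y.2 (Ideal.subset_span (Set.mem_insert _ _)))
        (Ideal.mul_mem_mul z.2 (Ideal.subset_span (Set.mem_insert_of_mem _ rfl)))

/-- The underlying set of `A_{mv,E}^{†,s}`: the series `∑_n F_n(Y_0) ∏_i (Y_i/Y_0)^{n_i}` with
`F_n ∈ A_E^{(p^{-1/s},1)}` and `F_n → 0` for the `(Y_0, ϖ / Y_0 ^ s)`-adic topology. -/
def AmvDaggerSet (f : ℕ) (s : ℕ+) : Set (Amv p E f) :=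
  {a | ∃ h : ∀ n, a.coeff n ∈ annulus p hϖ s, ∀ k : ℕ, ∀ᶠ n in cofinite,
    (⟨a.coeff n, h n⟩ : annulus p hϖ s) ∈ annulusIdeal p hϖ s ^ k}

theorem mem_AmvDaggerSet_iff {f : ℕ} {s : ℕ+} {a : Amv p E f} :
    a ∈ AmvDaggerSet p hϖ f s ↔ (∀ n m, Ord ϖ s 0 m ((a.coeff n).coeff m)) ∧
      ∀ k : ℕ, ∀ᶠ n in cofinite, ∀ m, Ord ϖ s k m ((a.coeff n).coeff m) := by
  simp only [AmvDaggerSet, annulusIdeal_pow]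
  constructor
  · rintro ⟨h, h'⟩
    exact ⟨fun n => (mem_annulus_iff p hϖ).1 (h n), h'⟩
  · rintro ⟨h, h'⟩
    exact ⟨fun n => (mem_annulus_iff p hϖ).2 (h n), h'⟩

/-- The ring `A_{mv,E}^{†,s}`, as a subring of `A_{mv,E}`. -/
def AmvDaggerS (f : ℕ) (s : ℕ+) : Subring (Amv p E f) where
  carrier := AmvDaggerSet p hϖ f s
  zero_mem' := (mem_AmvDaggerSet_iff p hϖ).2
    ⟨fun _ m => Ord.zero s 0 m, fun k => Eventually.of_forall fun _ m => Ord.zero s k m⟩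
  one_mem' := by
    have h : ∀ n m, Ord ϖ s 0 m (((1 : Amv p E f).coeff n).coeff m) := by
      intro n m
      change Ord ϖ s 0 m ((Pi.single 0 1 : (Fin (f - 1) → ℤ) × ℤ → E) (n, m))
      by_cases h : (n, m) = 0
      · rw [h, Pi.single_eq_same]
        obtain ⟨rfl, rfl⟩ := Prod.mk_eq_zero.1 h
        exact ⟨0, by simp⟩
      · rw [Pi.single_eq_of_ne h]
        exact Ord.zero s 0 m
    refine (mem_AmvDaggerSet_iff p hϖ).2 ⟨h, fun k => ?_⟩
    refine (Set.finite_singleton 0).subset fun n hn => ?_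
    by_contra hn0
    refine hn fun m => ?_
    change Ord ϖ s k m ((Pi.single 0 1 : (Fin (f - 1) → ℤ) × ℤ → E) (n, m))
    rw [Pi.single_eq_of_ne fun h => hn0 (Prod.mk_eq_zero.1 h).1]
    exact Ord.zero s k m
  neg_mem' {a} ha := by
    rw [mem_AmvDaggerSet_iff] at ha ⊢
    exact ⟨fun n m => (ha.1 n m).neg, fun k => (ha.2 k).mono fun n hn m => (hn m).neg⟩
  add_mem' {a b} ha hb := by
    have := isUltrametricDist p E
    rw [mem_AmvDaggerSet_iff] at ha hb ⊢
    exact ⟨fun n m => (ha.1 n m).add hϖ (hb.1 n m), fun k => by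
      filter_upwards [ha.2 k, hb.2 k] with n h1 h2 m using (h1 m).add hϖ (h2 m)⟩
  mul_mem' {a b} ha hb := by
    have := isUltrametricDist p E
    rw [mem_AmvDaggerSet_iff] at ha hb ⊢
    refine ⟨fun n m => Ord.tsum hϖ fun h => ?_, fun k => ?_⟩
    · simpa [Amv.fn] using (ha.1 h.1 h.2).mul (hb.1 (n - h.1) (m - h.2))
    · have fa : {n | ¬ ∀ m, Ord ϖ s k m ((a.coeff n).coeff m)}.Finite := ha.2 k
      have fb : {n | ¬ ∀ m, Ord ϖ s k m ((b.coeff n).coeff m)}.Finite := hb.2 k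
      refine ((fa.prod fb).image fun u => u.1 + u.2).subset ?_
      intro n hn
      by_contra H
      refine hn fun m => Ord.tsum hϖ fun h => ?_
      by_cases h1 : ∀ m, Ord ϖ s k m ((a.coeff h.1).coeff m)
      · simpa [Amv.fn] using (h1 h.2).mul (hb.1 (n - h.1) (m - h.2))
      by_cases h2 : ∀ m, Ord ϖ s k m ((b.coeff (n - h.1)).coeff m)
      · simpa [Amv.fn] using (ha.1 h.1 h.2).mul (h2 (m - h.2))
      · exact absurd ⟨(h.1, n - h.1), ⟨h1, h2⟩, by simp⟩ H

theorem Ord.mono_radius {s t : ℕ+} (hst : s ≤ t) {k : ℕ} {m : ℤ} {x : E} (h : Ord ϖ s k m x) :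
    Ord ϖ t k m x := by
  obtain ⟨v, h1, h2, h3⟩ := h
  have hst' : ((s : ℕ) : ℤ) ≤ (t : ℕ) := by exact_mod_cast hst
  have : ((s : ℕ) : ℤ) * v ≤ (t : ℕ) * v := mul_le_mul_of_nonneg_right hst' (Int.natCast_nonneg v)
  exact ⟨v, h1, by omega, by omega⟩

theorem AmvDaggerS_mono (f : ℕ) {s t : ℕ+} (hst : s ≤ t) :
    AmvDaggerS p hϖ f s ≤ AmvDaggerS p hϖ f t := by
  intro a ha
  obtain ⟨h1, h2⟩ := (mem_AmvDaggerSet_iff p hϖ).1 ha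
  exact (mem_AmvDaggerSet_iff p hϖ).2 ⟨fun n m => (h1 n m).mono_radius hst,
    fun k => (h2 k).mono fun n hn m => (hn m).mono_radius hst⟩

/-- The ring `A_{mv,E}^{†,∞}`, the union of the subrings `A_{mv,E}^{†,s}` for `s ≥ 1`. -/
def AmvDaggerInf (f : ℕ) : Subring (Amv p E f) where
  carrier := ⋃ s : ℕ+, (AmvDaggerS p hϖ f s : Set (Amv p E f))
  zero_mem' := Set.mem_iUnion.2 ⟨1, zero_mem _⟩
  one_mem' := Set.mem_iUnion.2 ⟨1, one_mem _⟩
  neg_mem' {a} ha := by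
    obtain ⟨s, hs⟩ := Set.mem_iUnion.1 ha
    exact Set.mem_iUnion.2 ⟨s, neg_mem hs⟩
  add_mem' {a b} ha hb := by
    obtain ⟨s, hs⟩ := Set.mem_iUnion.1 ha
    obtain ⟨t, ht⟩ := Set.mem_iUnion.1 hb
    exact Set.mem_iUnion.2 ⟨max s t, add_mem (AmvDaggerS_mono p hϖ f (le_max_left s t) hs)
      (AmvDaggerS_mono p hϖ f (le_max_right s t) ht)⟩
  mul_mem' {a b} ha hb := by
    obtain ⟨s, hs⟩ := Set.mem_iUnion.1 ha
    obtain ⟨t, ht⟩ := Set.mem_iUnion.1 hb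
    exact Set.mem_iUnion.2 ⟨max s t, mul_mem (AmvDaggerS_mono p hϖ f (le_max_left s t) hs)
      (AmvDaggerS_mono p hϖ f (le_max_right s t) ht)⟩

/-- The variable `Y_0` as a unit of `A_{mv,E}`. -/
noncomputable def Amv.Y₀ (E : Type*) [NormedField E] [NormedAlgebra ℚ_[p] E]
    [FiniteDimensional ℚ_[p] E] (f : ℕ) : (Amv p E f)ˣ where
  val := .mk' (Pi.single (0, 1) 1) (Good.single _ (by simp))
  inv := .mk' (Pi.single (0, -1) 1) (Good.single _ (by simp))
  val_inv := by
    apply Amv.fn_injective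
    ext u
    simp only [Amv.fn_mul, Amv.fn_mk', single_conv, one_mul, Amv.fn_one, Pi.single_apply]
    simp [sub_eq_iff_eq_add, Prod.mk_zero_zero]
  inv_val := by
    apply Amv.fn_injective
    ext u
    simp only [Amv.fn_mul, Amv.fn_mk', single_conv, one_mul, Amv.fn_one, Pi.single_apply]
    simp [sub_eq_iff_eq_add, Prod.mk_zero_zero]

theorem Amv.Y₀_mem (f : ℕ) : (Amv.Y₀ p E f : Amv p E f) ∈ AmvDaggerInf p hϖ f := by
  refine Set.mem_iUnion.2 ⟨1, (mem_AmvDaggerSet_iff p hϖ).2 ⟨fun n m => ?_, fun k => ?_⟩⟩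
  · change Ord ϖ 1 0 m ((Pi.single (0, 1) 1 : (Fin (f - 1) → ℤ) × ℤ → E) (n, m))
    by_cases h : (n, m) = (0, 1)
    · rw [h, Pi.single_eq_same]
      obtain ⟨rfl, rfl⟩ := Prod.mk.inj h
      exact ⟨0, by simp⟩
    · rw [Pi.single_eq_of_ne h]
      exact Ord.zero _ 0 m
  · refine (Set.finite_singleton 0).subset fun n hn => ?_
    by_contra hn0
    refine hn fun m => ?_
    change Ord ϖ 1 k m ((Pi.single (0, 1) 1 : (Fin (f - 1) → ℤ) × ℤ → E) (n, m))
    rw [Pi.single_eq_of_ne fun h => hn0 (Prod.mk.inj h).1]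
    exact Ord.zero _ k m

/-- The ring `A_{mv,E}^† = A_{mv,E}^{†,∞}[1/Y_0]`, as a subring of `A_{mv,E}`: its elements are the
`y / Y_0 ^ k` with `y ∈ A_{mv,E}^{†,∞}` and `k ≥ 0`. -/
noncomputable def AmvDagger (f : ℕ) : Subring (Amv p E f) where
  carrier := {a | ∃ k : ℕ, ∃ y ∈ AmvDaggerInf p hϖ f, a = y * (↑(Amv.Y₀ p E f)⁻¹ : Amv p E f) ^ k}
  zero_mem' := ⟨0, 0, zero_mem _, by simp⟩
  one_mem' := ⟨0, 1, one_mem _, by simp⟩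
  neg_mem' := by
    rintro _ ⟨k, y, hy, rfl⟩
    exact ⟨k, -y, neg_mem hy, by ring⟩
  add_mem' := by
    rintro _ _ ⟨k, y, hy, rfl⟩ ⟨l, z, hz, rfl⟩
    refine ⟨k + l, y * (Amv.Y₀ p E f : Amv p E f) ^ l + z * (Amv.Y₀ p E f : Amv p E f) ^ k,
      add_mem (mul_mem hy (pow_mem (Amv.Y₀_mem p hϖ f) l))
        (mul_mem hz (pow_mem (Amv.Y₀_mem p hϖ f) k)), ?_⟩
    have h : ∀ n, (Amv.Y₀ p E f : Amv p E f) ^ n * (↑(Amv.Y₀ p E f)⁻¹ : Amv p E f) ^ n = 1 := by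
      intro n
      rw [← mul_pow, Units.mul_inv, one_pow]
    rw [pow_add]
    linear_combination (-y * (↑(Amv.Y₀ p E f)⁻¹ : Amv p E f) ^ k) * h l -
      (z * (↑(Amv.Y₀ p E f)⁻¹ : Amv p E f) ^ l) * h k
  mul_mem' := by
    rintro _ _ ⟨k, y, hy, rfl⟩ ⟨l, z, hz, rfl⟩
    exact ⟨k + l, y * z, mul_mem hy hz, by ring⟩

end Dagger

end MvPhiGamma

/-! Write A for `Amv`, S_s for `AmvDaggerS` and X = ϖ / Y_0 ^ s. A term x Y_0 ^ m with |x| ≤ |ϖ| ^ v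
equals (x / ϖ ^ v) X ^ v Y_0 ^ (m + s v), so `Ord` measures its (X, Y_0)-adic order, and every
argument about S_s is made coefficient by coefficient.

Noetherianity. An element of S_s is divisible by X as soon as all its coefficients are divisible by
ϖ (`daggerX_dvd`). Hence S_s is complete for X, S_s / X is complete for Y_0, and S_s / (X, Y_0) is a
quotient of the Laurent polynomials in the U_i over the ring of integers. Two applications of
`isNoetherianRing_of_quotient_span_singleton` lift Noetherianity from this quotient to S_s, and it
passes to S_s[1/Y_0] (`daggerLoc`).

Flatness. As ϖ = X Y_0 ^ s, the elements ϖ and X generate the same ideal of S_s[1/Y_0]. This ring is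
saturated in A for ϖ (`mem_daggerLoc_of_uniformizer_mul`) and surjects onto A / ϖ
(`exists_daggerLoc_add_uniformizer_mul`). So A, which is ϖ-adically complete, is the ϖ-adic
completion of a Noetherian ring, hence flat over it. The ring `AmvDagger` is the directed union of
the S_s[1/Y_0], and flatness passes to the union; `AmvDagger` is also a localization of
`AmvDaggerInf`, which gives flatness over the latter.

Faithfulness. Enlarging s makes room to absorb denominators in Y_0: any multiple of ϖ in `AmvDagger`
lies in X S_r for r large, and S_r is X-adically complete. So ϖ is in the Jacobson radical of
`AmvDagger`. Since `AmvDagger` and A agree modulo ϖ, no maximal ideal of `AmvDagger` generates the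
unit ideal of A. -/

namespace MvPhiGamma

open Filter Topology

set_option linter.unusedSectionVars false

/-! ### Noetherianity and flatness via adic completeness -/

section CommutativeAlgebra

/-- A ring which is separated and complete for the powers of `x`, and whose quotient by `x` is
Noetherian, is Noetherian. -/
theorem isNoetherianRing_of_quotient_span_singleton {R : Type*} [CommRing R] (x : R)
    (hsep : ∀ a : R, (∀ n : ℕ, x ^ n ∣ a) → a = 0)
    (hsum : ∀ c : ℕ → R, ∃ L, ∀ n : ℕ, x ^ n ∣ L - ∑ i ∈ Finset.range n, c i * x ^ i)
    [IsNoetherianRing (R ⧸ Ideal.span {x})] : IsNoetherianRing R := by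
  refine IsNoetherianRing.of_prime fun P hP => ?_
  obtain ⟨r, v, hv⟩ := Submodule.fg_iff_exists_fin_generating_family.1
    (IsNoetherian.noetherian (P.map (Ideal.Quotient.mk (Ideal.span {x}))))
  change Ideal.span (Set.range v) = _ at hv
  have hmem : ∀ i, ∃ g ∈ P, Ideal.Quotient.mk (Ideal.span {x}) g = v i := fun i =>
    (Ideal.mem_map_iff_of_surjective _ Ideal.Quotient.mk_surjective).1
      (hv ▸ Ideal.subset_span ⟨i, rfl⟩)
  choose g hgP hg using hmem
  have step : ∀ a ∈ P, ∃ (c : Fin r → R) (b : R), a = ∑ i, c i * g i + x * b := by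
    intro a ha
    have h1 := Ideal.mem_map_of_mem (Ideal.Quotient.mk (Ideal.span {x})) ha
    rw [← hv, Ideal.mem_span_range_iff_exists_fun] at h1
    obtain ⟨c', hc'⟩ := h1
    choose c hc using fun i => Ideal.Quotient.mk_surjective (c' i)
    have h2 : Ideal.Quotient.mk (Ideal.span {x}) (a - ∑ i, c i * g i) = 0 := by
      simp [map_sum, hc, hg, hc']
    rw [Ideal.Quotient.eq_zero_iff_mem, Ideal.mem_span_singleton] at h2
    obtain ⟨b, hb⟩ := h2
    exact ⟨c, b, by rw [← hb]; ring⟩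
  have hsumP : ∀ c : Fin r → R, ∑ i, c i * g i ∈ P := fun c =>
    sum_mem fun i _ => P.mul_mem_left _ (hgP i)
  -- If x lies in P, the lifts g together with x generate P. If not, primality puts b back in P in
  -- the relation a = ∑ c_i g_i + x b, so the division can be iterated and the g alone suffice.
  by_cases hx : x ∈ P
  · refine Submodule.fg_def.2 ⟨Set.range g ∪ {x}, (Set.finite_range g).union (Set.finite_singleton x),
      le_antisymm ?_ fun a ha => ?_⟩
    · refine Submodule.span_le.2 ?_
      rintro _ (⟨i, rfl⟩ | rfl)
      exacts [hgP i, hx]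
    · obtain ⟨c, b, rfl⟩ := step a ha
      exact add_mem (sum_mem fun i _ => Ideal.mul_mem_left _ _
        (Ideal.subset_span (Or.inl ⟨i, rfl⟩)))
        (Ideal.mul_mem_right _ _ (Ideal.subset_span (Or.inr rfl)))
  · refine Submodule.fg_def.2 ⟨Set.range g, Set.finite_range g, le_antisymm ?_ fun a ha => ?_⟩
    · refine Submodule.span_le.2 ?_
      rintro _ ⟨i, rfl⟩
      exact hgP i
    · have step' : ∀ a : P, ∃ (c : Fin r → R) (b : P), a.1 = ∑ i, c i * g i + x * b.1 := by
        rintro ⟨a, ha⟩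
        obtain ⟨c, b, h⟩ := step a ha
        refine ⟨c, ⟨b, (hP.mem_or_mem (?_ : x * b ∈ P)).resolve_left hx⟩, h⟩
        rw [← sub_eq_iff_eq_add'.2 h]
        exact sub_mem ha (hsumP c)
      choose c b hb using step'
      let s : ℕ → P := fun n => b^[n] ⟨a, ha⟩
      have hs : ∀ n, (s n).1 = ∑ i, c (s n) i * g i + x * (s (n + 1)).1 := fun n => by
        rw [hb (s n)]
        simp only [s, Function.iterate_succ_apply']
      have hpart : ∀ n, a = ∑ i, (∑ j ∈ Finset.range n, c (s j) i * x ^ j) * g i +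
          x ^ n * (s n).1 := by
        intro n
        induction n with
        | zero => simp [s]
        | succ n ih =>
          have e : ∑ i, (∑ j ∈ Finset.range (n + 1), c (s j) i * x ^ j) * g i =
              ∑ i, (∑ j ∈ Finset.range n, c (s j) i * x ^ j) * g i +
                x ^ n * ∑ i, c (s n) i * g i := by
            rw [Finset.mul_sum, ← Finset.sum_add_distrib]
            refine Finset.sum_congr rfl fun i _ => ?_
            rw [Finset.sum_range_succ]
            ring
          rw [e]
          nth_rewrite 1 [ih]
          rw [hs n]
          ring
      -- The coefficients found at the successive stages are summed into power series in x;
      -- separatedness then identifies a with ∑ C_i g_i.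
      choose C hC using fun i => hsum fun j => c (s j) i
      have h0 : a - ∑ i, C i * g i = 0 := by
        refine hsep _ fun n => ?_
        have e : a - ∑ i, C i * g i = x ^ n * (s n).1 -
            ∑ i, (C i - ∑ j ∈ Finset.range n, c (s j) i * x ^ j) * g i := by
          simp only [sub_mul, Finset.sum_sub_distrib]
          linear_combination hpart n
        rw [e]
        exact dvd_sub (dvd_mul_right _ _)
          (Finset.dvd_sum fun i _ => (hC i n).mul_right _)
      rw [sub_eq_zero.1 h0]
      exact sum_mem fun i _ => Ideal.mul_mem_left _ _ (Ideal.subset_span ⟨i, rfl⟩)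

/-- A ring `R` is Noetherian if it is separated and complete for the powers of `x`, if `R / x` is
separated and complete for the powers of `y`, and if `R / (x, y)` is a quotient of a Noetherian
ring. -/
theorem isNoetherianRing_of_quotient_span_pair {D R : Type*} [CommRing D] [IsNoetherianRing D]
    [CommRing R] (φ : D →+* R) {x y : R} (hφ : ∀ a, ∃ d b c, a = φ d + x * b + y * c)
    (hsepx : ∀ a : R, (∀ n : ℕ, x ^ n ∣ a) → a = 0)
    (hsumx : ∀ c : ℕ → R, ∃ L, ∀ n : ℕ, x ^ n ∣ L - ∑ i ∈ Finset.range n, c i * x ^ i)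
    (hsepy : ∀ a : R, (∀ n : ℕ, ∃ b, x ∣ a - y ^ n * b) → x ∣ a)
    (hsumy : ∀ c : ℕ → R, ∃ L, ∀ n : ℕ, y ^ n ∣ L - ∑ i ∈ Finset.range n, c i * y ^ i) :
    IsNoetherianRing R := by
  let q := Ideal.Quotient.mk (Ideal.span {x})
  let q' := Ideal.Quotient.mk (Ideal.span {q y})
  have hX : q x = 0 := Ideal.Quotient.eq_zero_iff_mem.2 (Ideal.mem_span_singleton_self _)
  have hY : q' (q y) = 0 := Ideal.Quotient.eq_zero_iff_mem.2 (Ideal.mem_span_singleton_self _)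
  have : IsNoetherianRing ((R ⧸ Ideal.span {x}) ⧸ Ideal.span {q y}) := by
    refine isNoetherianRing_of_surjective _ _ (q'.comp (q.comp φ)) fun z => ?_
    obtain ⟨z, rfl⟩ := Ideal.Quotient.mk_surjective z
    obtain ⟨a, rfl⟩ := Ideal.Quotient.mk_surjective z
    obtain ⟨d, b, c, rfl⟩ := hφ a
    refine ⟨d, ?_⟩
    change _ = q' (q _)
    simp only [RingHom.comp_apply, map_add, map_mul, hX, hY, zero_mul, add_zero]
  have : IsNoetherianRing (R ⧸ Ideal.span {x}) := by
    refine isNoetherianRing_of_quotient_span_singleton (q y) ?_ ?_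
    · intro z hz
      obtain ⟨a, rfl⟩ := Ideal.Quotient.mk_surjective z
      rw [Ideal.Quotient.eq_zero_iff_mem, Ideal.mem_span_singleton]
      refine hsepy a fun n => ?_
      obtain ⟨b', hb⟩ := hz n
      obtain ⟨b, rfl⟩ := Ideal.Quotient.mk_surjective b'
      refine ⟨b, ?_⟩
      rw [← Ideal.mem_span_singleton, ← Ideal.Quotient.eq_zero_iff_mem, map_sub, map_mul, map_pow,
        hb, sub_self]
    · intro c'
      choose c hc using fun i => Ideal.Quotient.mk_surjective (c' i)
      obtain ⟨L, hL⟩ := hsumy c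
      refine ⟨q L, fun n => ?_⟩
      have := map_dvd q (hL n)
      simpa only [map_sub, map_sum, map_mul, map_pow, q, hc] using this
  exact isNoetherianRing_of_quotient_span_singleton x hsepx hsumx

/-- If every element of `S` becomes an element of the image of `R` after multiplication by a unit
and `R` is Noetherian, then so is `S`. -/
theorem isNoetherianRing_of_exists_unit_mul {R S : Type*} [CommRing R] [CommRing S]
    [IsNoetherianRing R] (φ : R →+* S) (h : ∀ a : S, ∃ (u : Sˣ) (b : R), u * a = φ b) :
    IsNoetherianRing S := by
  rw [isNoetherianRing_iff_ideal_fg]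
  intro J
  have e : J = (J.comap φ).map φ := by
    refine le_antisymm (fun a ha => ?_) Ideal.map_comap_le
    obtain ⟨u, b, hb⟩ := h a
    have : a = ↑u⁻¹ * φ b := by rw [← hb, Units.inv_mul_cancel_left]
    rw [this]
    refine Ideal.mul_mem_left _ _ (Ideal.mem_map_of_mem φ ?_)
    rw [Ideal.mem_comap, ← hb]
    exact J.mul_mem_left _ ha
  rw [e]
  exact Ideal.FG.map (IsNoetherian.noetherian _) φ

theorem mem_span_singleton_pow_smul_top {R M : Type*} [CommRing R] [AddCommGroup M] [Module R M]
    (x : R) (n : ℕ) (a : M) :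
    a ∈ (Ideal.span {x} ^ n • ⊤ : Submodule R M) ↔ ∃ b, a = x ^ n • b := by
  rw [Ideal.span_singleton_pow, Submodule.ideal_span_singleton_smul,
    Submodule.mem_smul_pointwise_iff_exists]
  simp [eq_comm]

theorem isAdicComplete_span_singleton {R M : Type*} [CommRing R] [AddCommGroup M] [Module R M]
    (x : R) (hsep : ∀ a : M, (∀ n : ℕ, ∃ b, a = x ^ n • b) → a = 0)
    (hsum : ∀ c : ℕ → M, ∃ L, ∀ n : ℕ, ∃ b, L - ∑ i ∈ Finset.range n, x ^ i • c i = x ^ n • b) :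
    IsAdicComplete (Ideal.span {x}) M where
  haus' a ha := hsep a fun n => by
    rw [← mem_span_singleton_pow_smul_top]
    exact SModEq.zero.1 (ha n)
  prec' g hg := by
    have hg' : ∀ n, ∃ b, g (n + 1) - g n = x ^ n • b := fun n => by
      rw [← mem_span_singleton_pow_smul_top, ← SModEq.sub_mem]
      exact (hg n.le_succ).symm
    choose c hc using hg'
    obtain ⟨L, hL⟩ := hsum c
    refine ⟨g 0 + L, fun n => ?_⟩
    have e : g n = g 0 + ∑ i ∈ Finset.range n, x ^ i • c i := by
      simp only [← hc, Finset.sum_range_sub]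
      abel
    obtain ⟨b, hb⟩ := hL n
    refine SModEq.symm ?_
    rw [SModEq.sub_mem, mem_span_singleton_pow_smul_top]
    exact ⟨b, by rw [← hb, e]; abel⟩

/-- Let `A` be an algebra over a Noetherian ring `S`, complete for the powers of `x ∈ S`, such that
`S` and `A` have the same quotients by the powers of `x`. Then `A` is flat over `S`. -/
theorem flat_of_isAdicComplete {S A : Type*} [CommRing S] [IsNoetherianRing S] [CommRing A]
    [Algebra S A] (x : S) [IsAdicComplete (Ideal.span {x}) A]
    (hinj : ∀ (n : ℕ) (a : S) (b : A), algebraMap S A a = x ^ n • b → ∃ c, a = x ^ n * c)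
    (hsurj : ∀ a : A, ∃ (b : S) (c : A), a = algebraMap S A b + x • c) : Module.Flat S A := by
  have hsurj' : ∀ (n : ℕ) (a : A), ∃ (b : S) (c : A), a = algebraMap S A b + x ^ n • c := by
    intro n
    induction n with
    | zero => exact fun a => ⟨0, a, by simp⟩
    | succ n ih =>
      intro a
      obtain ⟨b, c, rfl⟩ := ih a
      obtain ⟨b', c', rfl⟩ := hsurj c
      refine ⟨b + x ^ n * b', c', ?_⟩
      simp only [Algebra.smul_def, map_add, map_mul, map_pow]
      ring
  -- Agreement modulo all x ^ n makes the completions of S and A isomorphic, and A is its own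
  -- completion. Flatness is then that of the completion of a Noetherian ring.
  let ψ : AdicCompletion (Ideal.span {x}) S →ₗ[S] AdicCompletion (Ideal.span {x}) A :=
    (AdicCompletion.map (Ideal.span {x}) (Algebra.linearMap S A)).restrictScalars S
  have hψ : Function.Bijective ψ := by
    constructor
    · rw [injective_iff_map_eq_zero]
      intro a ha
      obtain ⟨g, rfl⟩ := AdicCompletion.mk_surjective _ _ a
      change AdicCompletion.map _ _ _ = _ at ha
      rw [AdicCompletion.map_mk] at ha
      ext n
      have h1 := congrArg (fun z => z.val n) ha
      simp only [AdicCompletion.mk_apply_coe, AdicCompletion.val_zero_apply] at h1 ⊢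
      rw [Submodule.mkQ_apply, Submodule.Quotient.mk_eq_zero, mem_span_singleton_pow_smul_top]
        at h1 ⊢
      obtain ⟨b, hb⟩ := h1
      exact hinj n _ b hb
    · intro a
      obtain ⟨g, rfl⟩ := AdicCompletion.mk_surjective _ _ a
      -- Approximate the n-th term by an element of S modulo x ^ n; `hinj` pulls the Cauchy
      -- congruences back from A to S.
      choose b c hbc using fun n => hsurj' n (g.1 n)
      refine ⟨AdicCompletion.mk _ _ (AdicCompletion.AdicCauchySequence.mk _ _ b fun n => ?_), ?_⟩
      · have h1 := g.2 n.le_succ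
        rw [SModEq.sub_mem, mem_span_singleton_pow_smul_top] at h1 ⊢
        obtain ⟨d, hd⟩ := h1
        refine hinj n _ (d - c n + x • c (n + 1)) ?_
        rw [hbc n, hbc (n + 1)] at hd
        rw [map_sub]
        simp only [Algebra.smul_def, map_pow] at hd ⊢
        linear_combination hd
      · change AdicCompletion.map _ _ _ = _
        rw [AdicCompletion.map_mk]
        ext n
        simp only [AdicCompletion.mk_apply_coe]
        rw [Submodule.mkQ_apply, Submodule.mkQ_apply, Submodule.Quotient.eq,
          mem_span_singleton_pow_smul_top]
        refine ⟨-c n, ?_⟩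
        rw [hbc n]
        change algebraMap S A (b n) - _ = _
        rw [smul_neg]
        abel
  exact Module.Flat.of_linearEquiv
    ((AdicCompletion.ofLinearEquiv (Ideal.span {x}) A).trans (LinearEquiv.ofBijective ψ hψ).symm)

/-- A ring which is flat over each member of a directed family of subrings is flat over any subring
which is their union. -/
theorem flat_of_directed_subring {A ι : Type*} [CommRing A] [Preorder ι] [Nonempty ι]
    [IsDirectedOrder ι] {B : Subring A} {S : ι → Subring A} (hS : Monotone S)
    (hle : ∀ i, S i ≤ B) (hB : ∀ a ∈ B, ∃ i, a ∈ S i) [∀ i, Module.Flat (S i) A] :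
    Module.Flat B A := by
  refine Module.Flat.of_forall_isTrivialRelation fun {l f x} h => ?_
  classical
  -- By the equational criterion flatness concerns one finite relation at a time, and its
  -- coefficients all lie in a single member of the family.
  choose i hi using fun j => hB _ (f j).2
  obtain ⟨m, hm⟩ := (Finset.univ.image i).exists_le
  let f' : Fin l → S m := fun j => ⟨f j, hS (hm _ (by simp)) (hi j)⟩
  obtain ⟨k, a, y, h1, h2⟩ := Module.Flat.iff_forall_isTrivialRelation.1
    (inferInstanceAs (Module.Flat (S m) A)) (f := f') (x := x) h
  refine ⟨k, fun i j => ⟨a i j, hle m (a i j).2⟩, y, h1, fun j => ?_⟩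
  have h3 := congrArg (Subtype.val) (h2 j)
  apply Subtype.ext
  simpa [f'] using h3

end CommutativeAlgebra

/-! ### The ring of integers is Noetherian -/

section IntegerRing

variable (E : Type*) [NormedField E] [IsUltrametricDist E]

/-- The ring of integers `{x ∈ E | ‖x‖ ≤ 1}` of `E`. -/
def integerRing : Subring E where
  carrier := {x | ‖x‖ ≤ 1}
  zero_mem' := by simp
  one_mem' := by simp
  neg_mem' := by simp
  add_mem' ha hb := (IsUltrametricDist.norm_add_le_max _ _).trans (max_le ha hb)
  mul_mem' {a b} ha hb := by
    change ‖a * b‖ ≤ 1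
    rw [norm_mul]
    exact mul_le_one₀ ha (norm_nonneg _) hb

variable {E}

/-- A nonzero prime contains an associate of some ϖ ^ v, hence ϖ; containing no unit, it consists of
multiples of ϖ. So every nonzero prime is generated by ϖ. -/
theorem IsUniformizer.isNoetherianRing_integerRing {ϖ : E} (hϖ : IsUniformizer ϖ) :
    IsNoetherianRing (integerRing E) := by
  refine IsNoetherianRing.of_prime_ne_bot fun P hP hbot => ?_
  obtain ⟨x, hxP, hx0⟩ := P.ne_bot_iff.1 hbot
  have hx0' : (x : E) ≠ 0 := fun h => hx0 (Subtype.ext h)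
  obtain ⟨v, hv⟩ := hϖ.exists_norm_eq hx0' x.2
  let π : integerRing E := ⟨ϖ, hϖ.norm_lt_one.le⟩
  have hπ : π ∈ P := by
    refine hP.mem_of_pow_mem v ?_
    have e : π ^ v = ⟨ϖ ^ v / x, by
        change ‖ϖ ^ v / (x : E)‖ ≤ 1
        rw [norm_div, norm_pow, hv]
        exact div_self_le_one _⟩ * x :=
      Subtype.ext (div_mul_cancel₀ _ hx0').symm
    rw [e]
    exact P.mul_mem_left _ hxP
  refine Submodule.fg_def.2 ⟨{π}, Set.finite_singleton _, le_antisymm ?_ fun y hy => ?_⟩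
  · exact Submodule.span_le.2 (Set.singleton_subset_iff.2 hπ)
  · have hy1 : ‖(y : E)‖ < 1 := by
      refine lt_of_le_of_ne y.2 fun h => hP.ne_top ((Ideal.eq_top_iff_one _).2 ?_)
      have hy0 : (y : E) ≠ 0 := norm_ne_zero_iff.1 (by rw [h]; exact one_ne_zero)
      have e : (1 : integerRing E) = ⟨(y : E)⁻¹, by
          change ‖(y : E)⁻¹‖ ≤ 1
          rw [norm_inv, h, inv_one]⟩ * y :=
        Subtype.ext (inv_mul_cancel₀ hy0).symm
      rw [e]
      exact P.mul_mem_left _ hy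
    obtain ⟨z, hz, hyz⟩ := (hϖ.2 _).1 hy1
    exact Ideal.mem_span_singleton.2 ⟨⟨z, hz⟩, Subtype.ext hyz⟩

end IntegerRing

/-! ### The (Y, ϖ / Y ^ s)-adic order of monomials -/

section Order

variable {E : Type*} [NormedField E] {ϖ : E}

theorem Ord.of_norm_le {s : ℕ+} {k : ℕ} {m : ℤ} {x y : E} (hx : Ord ϖ s k m x) (h : ‖y‖ ≤ ‖x‖) :
    Ord ϖ s k m y := by
  obtain ⟨v, h1, h2⟩ := hx
  exact ⟨v, h.trans h1, h2⟩

theorem Ord.exists_norm_lt (hϖ : IsUniformizer ϖ) (s : ℕ+) (m : ℤ) {ε : ℝ} (hε : 0 < ε) :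
    ∃ K : ℕ, ∀ m' ≤ m, ∀ x : E, Ord ϖ s K m' x → ‖x‖ < ε := by
  obtain ⟨N, hN⟩ := exists_pow_lt_of_lt_one hε hϖ.norm_lt_one
  -- Order at least K reads K ≤ m' + (s + 1) v, so this K forces v ≥ N.
  refine ⟨m.natAbs + (s + 1) * N, fun m' hm x hx => ?_⟩
  obtain ⟨v, h1, h2, h3⟩ := hx
  refine (h1.trans (pow_le_pow_of_le_one hϖ.norm_pos.le hϖ.norm_lt_one.le ?_)).trans_lt hN
  have hs : (1 : ℤ) ≤ (s : ℕ) := by exact_mod_cast s.pos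
  have := le_abs_self m
  push_cast at h3
  have h4 : ((s : ℕ) + 1 : ℤ) * N ≤ ((s : ℕ) + 1) * v := by linarith
  exact_mod_cast le_of_mul_le_mul_left h4 (by linarith)

theorem Ord.eq_zero (hϖ : IsUniformizer ϖ) {s : ℕ+} {m : ℤ} {x : E} (h : ∀ k, Ord ϖ s k m x) :
    x = 0 := by
  by_contra hx
  obtain ⟨K, hK⟩ := Ord.exists_norm_lt hϖ s m (norm_pos_iff.2 hx)
  exact lt_irrefl _ (hK m le_rfl x (h K))

/-- Dividing x Y ^ m by X = ϖ / Y ^ s removes one factor X. A witness v = 0 must be raised to 1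
beforehand, which the bound on x allows. -/
theorem Ord.div_uniformizer (hϖ : IsUniformizer ϖ) {s : ℕ+} {k : ℕ} {m : ℤ} {x : E}
    (h : Ord ϖ s k m x) (hx : ‖x‖ ≤ ‖ϖ‖) : Ord ϖ s (k - 1) (m + s) (x / ϖ) := by
  have key : ∃ w : ℕ, ‖x‖ ≤ ‖ϖ‖ ^ (w + 1) ∧ 0 ≤ m + s * (w + 1 : ℤ) ∧
      (k : ℤ) ≤ (w + 1) + (m + s * (w + 1 : ℤ)) := by
    obtain ⟨v, h1, h2, h3⟩ := h
    cases v with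
    | zero => exact ⟨0, by simpa using hx, by push_cast at *; omega, by push_cast at *; omega⟩
    | succ w => exact ⟨w, h1, by push_cast at *; omega, by push_cast at *; omega⟩
  obtain ⟨w, h1, h2, h3⟩ := key
  have e : ((s : ℕ) : ℤ) * (w + 1 : ℤ) = s + s * w := by ring
  rw [e] at h2 h3
  refine ⟨w, ?_, by omega, by omega⟩
  rw [norm_div, div_le_iff₀ hϖ.norm_pos, ← pow_succ]
  exact h1

/-- Such a coefficient admits only the witness v = 0, so its order is governed by the degree in Y
alone: this is what the order becomes modulo X. -/
theorem Ord.le_of_norm_lt {s : ℕ+} {k : ℕ} {m : ℤ} {x : E} (hϖ : IsUniformizer ϖ)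
    (h : Ord ϖ s k m x) (hx : ‖ϖ‖ < ‖x‖) : (k : ℤ) ≤ m := by
  obtain ⟨v, h1, h2, h3⟩ := h
  obtain rfl : v = 0 := by
    by_contra hv
    have : ‖ϖ‖ ^ v ≤ ‖ϖ‖ := pow_le_of_le_one hϖ.norm_pos.le hϖ.norm_lt_one.le hv
    linarith
  simpa using h3

theorem Ord.of_le {s : ℕ+} {k : ℕ} {m : ℤ} {x : E} (hx : ‖x‖ ≤ 1) (h : (k : ℤ) ≤ m) :
    Ord ϖ s k m x :=
  ⟨0, by simpa using hx, by push_cast; omega, by push_cast; omega⟩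

variable {L : Type*} [AddCommGroup L]

/-- The conditions on the coefficients of an element of `A_{mv,E}` which define
`A_{mv,E}^{†,s}`. -/
structure OrdGood (ϖ : E) (s : ℕ+) (x : L × ℤ → E) : Prop where
  ord : ∀ g, Ord ϖ s 0 g.2 (x g)
  eventually : ∀ k : ℕ, ∀ᶠ n in cofinite, ∀ m, Ord ϖ s k m (x (n, m))

/-- The topology of `AmvDaggerS` is finer than that of `Amv`: in bounded degree, large order forces
small norm. A norm at least ε also bounds v, and so bounds the degree below by -s M. -/
theorem OrdGood.good (hϖ : IsUniformizer ϖ) {s : ℕ+} {x : L × ℤ → E} (hx : OrdGood ϖ s x) :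
    Good (degY L) x where
  le_one g := by
    obtain ⟨v, hv, -⟩ := hx.ord g
    exact hv.trans (pow_le_one₀ (norm_nonneg _) hϖ.norm_lt_one.le)
  finite ε hε N := by
    obtain ⟨K, hK⟩ := Ord.exists_norm_lt hϖ s N hε
    obtain ⟨M, hM⟩ := exists_pow_lt_of_lt_one hε hϖ.norm_lt_one
    have hfin : {n | ¬ ∀ m, Ord ϖ s K m (x (n, m))}.Finite := hx.eventually K
    refine (hfin.prod (Set.finite_Ico (-((s : ℕ) * M : ℤ)) N)).subset ?_
    rintro ⟨n, m⟩ ⟨hm, hn⟩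
    refine ⟨fun H => not_lt.2 hn (hK m (le_of_lt hm) _ (H m)), ?_, hm⟩
    obtain ⟨v, h1, h2, -⟩ := hx.ord (n, m)
    have hv : v ≤ M := by
      by_contra! H
      have := pow_le_pow_of_le_one hϖ.norm_pos.le hϖ.norm_lt_one.le H.le
      linarith
    have : ((s : ℕ) : ℤ) * v ≤ (s : ℕ) * M :=
      mul_le_mul_of_nonneg_left (by exact_mod_cast hv) (Int.natCast_nonneg _)
    simp only at h2 ⊢
    linarith

/-- This permits cutting a series according to the size of its coefficients. -/
theorem OrdGood.of_norm_le {s : ℕ+} {x y : L × ℤ → E} (hx : OrdGood ϖ s x)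
    (h : ∀ g, ‖y g‖ ≤ ‖x g‖) : OrdGood ϖ s y where
  ord g := (hx.ord g).of_norm_le (h g)
  eventually k := (hx.eventually k).mono fun _ hn m => (hn m).of_norm_le (h _)

end Order

/-! ### Coefficients and ϖ-adic completeness of `Amv` -/

section Coefficients

variable {p : ℕ} [Fact p.Prime] {E : Type*} [NormedField E] [NormedAlgebra ℚ_[p] E]
  [FiniteDimensional ℚ_[p] E] {f : ℕ}

@[simp] theorem Amv.fn_sub (a b : Amv p E f) : (a - b).fn = a.fn - b.fn := by
  rw [sub_eq_add_neg, fn_add, fn_neg, sub_eq_add_neg]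

theorem Amv.fn_sum {ι : Type*} (s : Finset ι) (a : ι → Amv p E f) :
    (∑ i ∈ s, a i).fn = ∑ i ∈ s, (a i).fn :=
  map_sum (AddMonoidHom.mk' (Amv.fn : Amv p E f → _) Amv.fn_add) a s

variable (p) in
/-- The monomial `c U ^ u.1 Y_0 ^ u.2`. -/
noncomputable def Amv.monomial (u : (Fin (f - 1) → ℤ) × ℤ) (c : E) (hc : ‖c‖ ≤ 1) : Amv p E f :=
  .mk' (Pi.single u c) (Good.single u hc)

@[simp] theorem Amv.fn_monomial (u : (Fin (f - 1) → ℤ) × ℤ) (c : E) (hc : ‖c‖ ≤ 1) :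
    (Amv.monomial p u c hc).fn = Pi.single u c := rfl

@[simp] theorem Amv.fn_monomial_mul (u : (Fin (f - 1) → ℤ) × ℤ) (c : E) (hc : ‖c‖ ≤ 1)
    (a : Amv p E f) (g : (Fin (f - 1) → ℤ) × ℤ) :
    (Amv.monomial p u c hc * a).fn g = c * a.fn (g - u) :=
  single_conv u c a.fn g

theorem Amv.monomial_mul_monomial (u v : (Fin (f - 1) → ℤ) × ℤ) (c d : E) (hc : ‖c‖ ≤ 1)
    (hd : ‖d‖ ≤ 1) : Amv.monomial p u c hc * Amv.monomial p v d hd =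
      Amv.monomial p (u + v) (c * d)
        (by rw [norm_mul]; exact mul_le_one₀ hc (norm_nonneg _) hd) := by
  apply Amv.fn_injective
  ext g
  simp only [fn_monomial_mul, fn_monomial, Pi.single_apply, sub_eq_iff_eq_add', mul_ite, mul_zero]

theorem Amv.monomial_add (u : (Fin (f - 1) → ℤ) × ℤ) (c d : E) (hc : ‖c‖ ≤ 1)
    (hd : ‖d‖ ≤ 1) (h : ‖c + d‖ ≤ 1) : Amv.monomial p u (c + d) h =
      Amv.monomial p u c hc + Amv.monomial p u d hd :=
  Amv.fn_injective (Pi.single_add (f := fun _ => E) u c d)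

theorem Amv.monomial_zero (u : (Fin (f - 1) → ℤ) × ℤ) :
    Amv.monomial p u (0 : E) (by simp) = 0 :=
  Amv.fn_injective (Pi.single_zero u)

theorem Amv.monomial_one : Amv.monomial p (0 : (Fin (f - 1) → ℤ) × ℤ) (1 : E) (by simp) = 1 := rfl

theorem Amv.Y₀_pow (k : ℕ) :
    (Amv.Y₀ p E f : Amv p E f) ^ k = Amv.monomial p (0, (k : ℤ)) 1 (by simp) := by
  induction k with
  | zero => exact Amv.monomial_one.symm
  | succ k ih =>
    rw [pow_succ, ih]
    change _ * Amv.monomial p (0, 1) 1 (by simp) = _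
    rw [Amv.monomial_mul_monomial]
    simp

variable {ϖ : E} (hϖ : IsUniformizer ϖ)

variable (p f) in
/-- The uniformizer as an element of `A_{mv,E}`. -/
noncomputable def Amv.uniformizer : Amv p E f := .monomial p 0 ϖ hϖ.norm_lt_one.le

@[simp] theorem Amv.fn_uniformizer_mul (a : Amv p E f) (g : (Fin (f - 1) → ℤ) × ℤ) :
    (Amv.uniformizer p f hϖ * a).fn g = ϖ * a.fn g := by
  simp [uniformizer]

theorem Amv.fn_uniformizer_pow_mul (n : ℕ) (a : Amv p E f) (g : (Fin (f - 1) → ℤ) × ℤ) :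
    (Amv.uniformizer p f hϖ ^ n * a).fn g = ϖ ^ n * a.fn g := by
  induction n with
  | zero => simp
  | succ n ih => rw [pow_succ', mul_assoc, fn_uniformizer_mul, ih, pow_succ', mul_assoc]

theorem Amv.uniformizer_mul_cancel {a b : Amv p E f}
    (h : Amv.uniformizer p f hϖ * a = Amv.uniformizer p f hϖ * b) : a = b := by
  apply Amv.fn_injective
  ext g
  have := congrArg (fun z => Amv.fn z g) h
  simp only [fn_uniformizer_mul] at this
  exact mul_left_cancel₀ hϖ.1 this

theorem Amv.eq_zero_of_uniformizer_pow_dvd {a : Amv p E f}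
    (h : ∀ n : ℕ, Amv.uniformizer p f hϖ ^ n ∣ a) : a = 0 := by
  apply Amv.fn_injective
  ext g
  by_contra hg
  obtain ⟨N, hN⟩ := exists_pow_lt_of_lt_one (norm_pos_iff.2 hg) hϖ.norm_lt_one
  obtain ⟨b, rfl⟩ := h N
  rw [fn_uniformizer_pow_mul, norm_mul, norm_pow] at hN
  have := mul_le_of_le_one_right (pow_nonneg (norm_nonneg ϖ) N) (b.good.le_one g)
  linarith

include hϖ in
theorem Good.tsum_uniformizer_pow {c : ℕ → (Fin (f - 1) → ℤ) × ℤ → E} [IsUltrametricDist E]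
    (hc : ∀ i, Good (degY _) (c i)) : Good (degY _) fun g => ∑' i, ϖ ^ i * c i g where
  le_one g := norm_tsum_le_of zero_le_one fun i => by
    rw [norm_mul, norm_pow]
    exact mul_le_one₀ (pow_le_one₀ (norm_nonneg _) hϖ.norm_lt_one.le) (norm_nonneg _)
      ((hc i).le_one g)
  finite ε hε N := by
    obtain ⟨K, hK⟩ := exists_pow_lt_of_lt_one (half_pos hε) hϖ.norm_lt_one
    refine ((Set.finite_Iio K).biUnion fun i _ => (hc i).finite _ (half_pos hε) N).subset ?_
    rintro g ⟨hg, hn⟩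
    -- Terms all below ε would only bound the sum by ε, without strict inequality; hence ε / 2.
    obtain ⟨i, hi⟩ : ∃ i, ε / 2 ≤ ‖ϖ ^ i * c i g‖ := by
      by_contra! H
      have := norm_tsum_le_of (half_pos hε).le fun i => (H i).le
      linarith
    obtain ⟨h1, h2⟩ := norm_mul_ge
      (by rw [norm_pow]; exact pow_le_one₀ (norm_nonneg _) hϖ.norm_lt_one.le) ((hc i).le_one g) hi
    refine Set.mem_biUnion (?_ : i < K) ⟨hg, h2⟩
    by_contra! H
    have := pow_le_pow_of_le_one hϖ.norm_pos.le hϖ.norm_lt_one.le H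
    rw [norm_pow] at h1
    linarith

theorem Amv.exists_sum_uniformizer_pow (c : ℕ → Amv p E f) :
    ∃ L : Amv p E f, ∀ n : ℕ, Amv.uniformizer p f hϖ ^ n ∣
      L - ∑ i ∈ Finset.range n, Amv.uniformizer p f hϖ ^ i * c i := by
  have := isUltrametricDist p E
  have := completeSpace p E
  -- The shifted tails satisfy F n = c n + ϖ F (n + 1), so F n is exactly the quotient by ϖ ^ n of
  -- the n-th remainder of F 0.
  let F : ℕ → Amv p E f := fun n =>
    .mk' _ (Good.tsum_uniformizer_pow hϖ fun i => (c (i + n)).good)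
  have hF : ∀ n, F n = c n + Amv.uniformizer p f hϖ * F (n + 1) := by
    intro n
    apply Amv.fn_injective
    ext g
    have hs : Summable fun i => ϖ ^ i * (c (i + n)).fn g := by
      refine Summable.of_norm_bounded
        (summable_geometric_of_lt_one (norm_nonneg _) hϖ.norm_lt_one) fun i => ?_
      rw [norm_mul, norm_pow]
      exact mul_le_of_le_one_right (pow_nonneg (norm_nonneg _) _) ((c (i + n)).good.le_one g)
    rw [fn_add, Pi.add_apply, fn_uniformizer_mul]
    simp only [F, fn_mk']
    rw [hs.tsum_eq_zero_add, ← tsum_mul_left]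
    simp only [pow_zero, one_mul, zero_add, pow_succ', mul_assoc, add_right_comm, add_assoc]
  refine ⟨F 0, fun n => ⟨F n, ?_⟩⟩
  induction n with
  | zero => simp
  | succ n ih =>
    rw [Finset.sum_range_succ, ← sub_sub, ih, hF n]
    ring

end Coefficients

/-! ### Divisibility and completeness in `AmvDaggerS` -/

section DaggerS

variable {p : ℕ} [Fact p.Prime] {E : Type*} [NormedField E] [NormedAlgebra ℚ_[p] E]
  [FiniteDimensional ℚ_[p] E] {ϖ : E} (hϖ : IsUniformizer ϖ) {f : ℕ} {s : ℕ+}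

theorem mem_AmvDaggerS {a : Amv p E f} : a ∈ AmvDaggerS p hϖ f s ↔ OrdGood ϖ s a.fn := by
  refine (mem_AmvDaggerSet_iff p hϖ).trans ⟨fun h => ⟨fun g => h.1 g.1 g.2, h.2⟩,
    fun h => ⟨fun n m => h.1 (n, m), h.2⟩⟩

variable (p) in
/-- The element of `A_{mv,E}^{†,s}` with given coefficients. -/
def OrdGood.toDaggerS {x : (Fin (f - 1) → ℤ) × ℤ → E} (hx : OrdGood ϖ s x) :
    AmvDaggerS p hϖ f s :=
  ⟨.mk' x (hx.good hϖ), (mem_AmvDaggerS hϖ).2 hx⟩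

@[simp] theorem OrdGood.fn_toDaggerS {x : (Fin (f - 1) → ℤ) × ℤ → E} (hx : OrdGood ϖ s x) :
    (hx.toDaggerS p hϖ).1.fn = x := rfl

theorem AmvDaggerS.ordGood (a : AmvDaggerS p hϖ f s) : OrdGood ϖ s a.1.fn :=
  (mem_AmvDaggerS hϖ).1 a.2

theorem OrdGood.single [DecidableEq ((Fin (f - 1) → ℤ) × ℤ)] {u : (Fin (f - 1) → ℤ) × ℤ} {c : E}
    (h : Ord ϖ s 0 u.2 c) : OrdGood ϖ s (Pi.single u c : (Fin (f - 1) → ℤ) × ℤ → E) where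
  ord g := by
    by_cases hg : g = u
    · subst hg; simpa using h
    · rw [Pi.single_eq_of_ne hg]; exact Ord.zero _ _ _
  eventually k := by
    refine (Set.finite_singleton u.1).subset fun n hn => ?_
    by_contra hn0
    refine hn fun m => ?_
    rw [Pi.single_eq_of_ne fun h : (n, m) = u => hn0 (congrArg Prod.fst h)]
    exact Ord.zero _ _ _

variable (p f s) in
/-- The element `ϖ / Y_0 ^ s` of `A_{mv,E}^{†,s}`. -/
noncomputable def daggerX : AmvDaggerS p hϖ f s :=
  ⟨.monomial p (0, -(s : ℤ)) ϖ hϖ.norm_lt_one.le,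
    (mem_AmvDaggerS hϖ).2 (OrdGood.single ((ord_X s).mono zero_le_one))⟩

variable (p f s) in
/-- The element `Y_0` of `A_{mv,E}^{†,s}`. -/
noncomputable def daggerY : AmvDaggerS p hϖ f s :=
  ⟨.monomial p (0, 1) 1 (by simp),
    (mem_AmvDaggerS hϖ).2 (OrdGood.single ((ord_Y s).mono zero_le_one))⟩

theorem fn_daggerX_mul (a : AmvDaggerS p hϖ f s) (g : (Fin (f - 1) → ℤ) × ℤ) :
    (daggerX p hϖ f s * a).1.fn g = ϖ * a.1.fn (g - (0, -(s : ℤ))) :=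
  Amv.fn_monomial_mul _ _ hϖ.norm_lt_one.le _ _

theorem fn_daggerY_mul (a : AmvDaggerS p hϖ f s) (g : (Fin (f - 1) → ℤ) × ℤ) :
    (daggerY p hϖ f s * a).1.fn g = a.1.fn (g - (0, 1)) :=
  (Amv.fn_monomial_mul _ 1 (by simp) _ _).trans (one_mul _)

theorem fn_daggerY_pow_mul (k : ℕ) (a : AmvDaggerS p hϖ f s) (g : (Fin (f - 1) → ℤ) × ℤ) :
    (daggerY p hϖ f s ^ k * a).1.fn g = a.1.fn (g - (0, (k : ℤ))) := by
  induction k generalizing g with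
  | zero =>
    have : ((0, ((0 : ℕ) : ℤ)) : (Fin (f - 1) → ℤ) × ℤ) = 0 := rfl
    rw [this]
    simp
  | succ k ih =>
    rw [pow_succ', mul_assoc, fn_daggerY_mul, ih]
    congr 1
    ext <;> simp
    ring

/-- The substance is that ϖ-divisibility in `Amv` already gives X-divisibility in `AmvDaggerS`: the
quotient has order at most one less, so the convergence condition survives. -/
theorem daggerX_dvd {a : AmvDaggerS p hϖ f s} :
    daggerX p hϖ f s ∣ a ↔ ∀ g, ‖a.1.fn g‖ ≤ ‖ϖ‖ := by
  constructor
  · rintro ⟨b, rfl⟩ g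
    rw [fn_daggerX_mul, norm_mul]
    exact mul_le_of_le_one_right (norm_nonneg _) (b.1.good.le_one _)
  · intro h
    have hb : OrdGood ϖ s fun g => a.1.fn (g + (0, -(s : ℤ))) / ϖ := by
      constructor
      · intro g
        have := ((AmvDaggerS.ordGood hϖ a).ord (g + (0, -(s : ℤ)))).div_uniformizer hϖ (h _)
        simpa using this
      · intro k
        filter_upwards [(AmvDaggerS.ordGood hϖ a).eventually (k + 1)] with n hn m
        have := (hn (m - s)).div_uniformizer hϖ (h _)
        simpa [sub_eq_add_neg] using this
    refine ⟨hb.toDaggerS p hϖ, Subtype.ext (Amv.fn_injective (funext fun g => ?_))⟩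
    rw [fn_daggerX_mul, OrdGood.fn_toDaggerS, sub_add_cancel, mul_div_cancel₀ _ hϖ.1]

/-- For coefficients of norm above that of ϖ the order is the degree, so shifting the degree down by
one costs one order; degrees at least 1 stay nonnegative. -/
theorem daggerY_dvd {a : AmvDaggerS p hϖ f s}
    (h : ∀ g, a.1.fn g ≠ 0 → ‖ϖ‖ < ‖a.1.fn g‖ ∧ 1 ≤ g.2) : daggerY p hϖ f s ∣ a := by
  have key : ∀ k g, Ord ϖ s (k + 1) g.2 (a.1.fn g) → Ord ϖ s k (g.2 - 1) (a.1.fn g) := by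
    intro k g hk
    by_cases h0 : a.1.fn g = 0
    · rw [h0]; exact Ord.zero _ _ _
    · refine Ord.of_le (a.1.good.le_one _) ?_
      have := hk.le_of_norm_lt hϖ (h g h0).1
      push_cast at this
      omega
  have hb : OrdGood ϖ s fun g => a.1.fn (g + (0, 1)) := by
    constructor
    · intro g
      by_cases h0 : a.1.fn (g + (0, 1)) = 0
      · rw [h0]; exact Ord.zero _ _ _
      · refine Ord.of_le (a.1.good.le_one _) ?_
        have := (h _ h0).2
        simp at this
        simpa using this
    · intro k
      filter_upwards [(AmvDaggerS.ordGood hϖ a).eventually (k + 1)] with n hn m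
      simpa using key k (n, m + 1) (hn (m + 1))
  refine ⟨hb.toDaggerS p hϖ, Subtype.ext (Amv.fn_injective (funext fun g => ?_))⟩
  rw [fn_daggerY_mul, OrdGood.fn_toDaggerS, sub_add_cancel]

-- Modulo order k only the terms with i < k matter, leaving finitely many cofinite conditions to
-- intersect.
include hϖ in
theorem OrdGood.tsum [IsUltrametricDist E] {c : ℕ → (Fin (f - 1) → ℤ) × ℤ → E}
    (hc : ∀ i, OrdGood ϖ s (c i)) (h : ∀ i g, Ord ϖ s i g.2 (c i g)) :
    OrdGood ϖ s fun g => ∑' i, c i g where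
  ord g := Ord.tsum hϖ fun i => (hc i).ord g
  eventually k := by
    have := (Set.finite_Iio k).eventually_all.2 fun i _ => (hc i).eventually k
    filter_upwards [this] with n hn m
    refine Ord.tsum hϖ fun i => ?_
    by_cases hi : i < k
    · exact hn i hi m
    · exact (h i (n, m)).mono (not_lt.1 hi)

/-- Convergence of the series `∑ c_i z ^ i` in `A_{mv,E}^{†,s}`, for `z` a monomial of positive
order. -/
theorem AmvDaggerS.exists_sum_pow {z : AmvDaggerS p hϖ f s} {u : (Fin (f - 1) → ℤ) × ℤ} {e : E}
    (he : Ord ϖ s 1 u.2 e)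
    (hz : ∀ (a : AmvDaggerS p hϖ f s) g, (z * a).1.fn g = e * a.1.fn (g - u))
    (c : ℕ → AmvDaggerS p hϖ f s) :
    ∃ L, ∀ n : ℕ, z ^ n ∣ L - ∑ i ∈ Finset.range n, c i * z ^ i := by
  have := isUltrametricDist p E
  have := completeSpace p E
  have hord : ∀ (a : AmvDaggerS p hϖ f s) (i : ℕ) g, Ord ϖ s i g.2 ((z ^ i * a).1.fn g) := by
    intro a i
    induction i with
    | zero => intro g; simpa using (AmvDaggerS.ordGood hϖ a).ord g
    | succ i ih =>
      intro g
      rw [pow_succ', mul_assoc, hz, add_comm i 1]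
      simpa using he.mul (ih (g - u))
  -- Again the tails: F n = c n + z F (n + 1). They converge because z ^ i raises the order by i.
  let F : ℕ → AmvDaggerS p hϖ f s := fun n => (OrdGood.tsum hϖ
    (fun i => AmvDaggerS.ordGood hϖ (z ^ i * c (i + n))) fun i => hord (c (i + n)) i).toDaggerS p hϖ
  have hF : ∀ n, F n = c n + z * F (n + 1) := by
    intro n
    apply Subtype.ext
    apply Amv.fn_injective
    ext g
    have hs : Summable fun i => (z ^ i * c (i + n)).1.fn g := by
      apply summable_of_finite
      intro ε hε
      obtain ⟨K, hK⟩ := Ord.exists_norm_lt hϖ s g.2 hε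
      refine (Set.finite_Iio K).subset fun i hi => ?_
      by_contra H
      exact not_lt.2 hi (hK _ le_rfl _ ((hord _ i g).mono (not_lt.1 H)))
    have e1 : (c n + z * F (n + 1)).1.fn g = (c n).1.fn g + (z * F (n + 1)).1.fn g := rfl
    rw [e1, hz]
    simp only [F, OrdGood.fn_toDaggerS]
    rw [hs.tsum_eq_zero_add, ← tsum_mul_left]
    simp only [pow_zero, one_mul, zero_add, pow_succ', mul_assoc, hz, add_right_comm, add_assoc]
  refine ⟨F 0, fun n => ⟨F n, ?_⟩⟩
  induction n with
  | zero => simp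
  | succ n ih =>
    rw [Finset.sum_range_succ, ← sub_sub, ih, hF n]
    ring

theorem daggerX_exists_sum (c : ℕ → AmvDaggerS p hϖ f s) :
    ∃ L, ∀ n : ℕ, daggerX p hϖ f s ^ n ∣ L - ∑ i ∈ Finset.range n, c i * daggerX p hϖ f s ^ i :=
  AmvDaggerS.exists_sum_pow hϖ (ord_X s) (fn_daggerX_mul hϖ) c

theorem daggerY_exists_sum (c : ℕ → AmvDaggerS p hϖ f s) :
    ∃ L, ∀ n : ℕ, daggerY p hϖ f s ^ n ∣ L - ∑ i ∈ Finset.range n, c i * daggerY p hϖ f s ^ i :=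
  AmvDaggerS.exists_sum_pow hϖ (ord_Y s)
    (fun a g => (fn_daggerY_mul hϖ a g).trans (one_mul _).symm) c

theorem eq_zero_of_daggerX_pow_dvd {a : AmvDaggerS p hϖ f s}
    (h : ∀ n : ℕ, daggerX p hϖ f s ^ n ∣ a) : a = 0 := by
  have hord : ∀ (n : ℕ) (b : AmvDaggerS p hϖ f s) g,
      Ord ϖ s n g.2 ((daggerX p hϖ f s ^ n * b).1.fn g) := by
    intro n b
    induction n with
    | zero => intro g; simpa using (AmvDaggerS.ordGood hϖ b).ord g
    | succ n ih =>
      intro g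
      rw [pow_succ', mul_assoc, fn_daggerX_mul, add_comm n 1]
      have := (ord_X s).mul (ih (g - (0, -(s : ℤ))))
      rwa [Prod.snd_sub, add_sub_cancel] at this
  apply Subtype.ext
  apply Amv.fn_injective
  ext g
  refine Ord.eq_zero hϖ (s := s) (m := g.2) fun k => ?_
  obtain ⟨b, rfl⟩ := h k
  exact hord k b g

instance daggerX_isAdicComplete :
    IsAdicComplete (Ideal.span {daggerX p hϖ f s}) (AmvDaggerS p hϖ f s) := by
  refine isAdicComplete_span_singleton _
    (fun a h => eq_zero_of_daggerX_pow_dvd hϖ fun n => h n) fun c => ?_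
  obtain ⟨L, hL⟩ := daggerX_exists_sum hϖ c
  refine ⟨L, fun n => ?_⟩
  obtain ⟨b, hb⟩ := hL n
  refine ⟨b, ?_⟩
  simp only [smul_eq_mul, ← hb, mul_comm]

theorem daggerX_dvd_of_forall {a : AmvDaggerS p hϖ f s}
    (h : ∀ n : ℕ, ∃ b, daggerX p hϖ f s ∣ a - daggerY p hϖ f s ^ n * b) :
    daggerX p hϖ f s ∣ a := by
  have := isUltrametricDist p E
  rw [daggerX_dvd]
  intro g
  -- This exponent exceeds g.2, so the coefficient of Y_0 ^ n b at g comes from b in negative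
  -- degree, where norms are at most that of ϖ.
  obtain ⟨b, hb⟩ := h (g.2.toNat + 1)
  rw [daggerX_dvd] at hb
  have e : a.1.fn g = (a - daggerY p hϖ f s ^ (g.2.toNat + 1) * b).1.fn g +
      (daggerY p hϖ f s ^ (g.2.toNat + 1) * b).1.fn g := by
    rw [← Pi.add_apply, ← Amv.fn_add, ← Subring.coe_add, sub_add_cancel]
  rw [e]
  refine (IsUltrametricDist.norm_add_le_max _ _).trans (max_le (hb g) ?_)
  rw [fn_daggerY_pow_mul]
  by_contra! H
  have := ((AmvDaggerS.ordGood hϖ b).ord _).le_of_norm_lt hϖ H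
  simp at this

end DaggerS

/-! ### `AmvDaggerS` is Noetherian -/

section Noetherian

variable {p : ℕ} [Fact p.Prime] {E : Type*} [NormedField E] [NormedAlgebra ℚ_[p] E]
  [FiniteDimensional ℚ_[p] E] {ϖ : E} (hϖ : IsUniformizer ϖ) {f : ℕ} {s : ℕ+}

/-- The monomial `c U ^ n` of `A_{mv,E}^{†,s}`. -/
noncomputable def daggerU (s : ℕ+) (n : Fin (f - 1) → ℤ) (c : E) (hc : ‖c‖ ≤ 1) :
    AmvDaggerS p hϖ f s :=
  ⟨.monomial p (n, 0) c hc, (mem_AmvDaggerS hϖ).2 (OrdGood.single (Ord.of_le hc (by simp)))⟩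

variable (p f s) in
/-- The inclusion of the Laurent polynomials in the `U_i` with integral coefficients. -/
noncomputable def daggerLaurent [IsUltrametricDist E] :
    AddMonoidAlgebra (integerRing E) (Fin (f - 1) → ℤ) →+* AmvDaggerS p hϖ f s :=
  AddMonoidAlgebra.liftNCRingHom
    { toFun := fun c => daggerU hϖ s 0 c.1 c.2
      map_one' := rfl
      map_mul' := fun c d => Subtype.ext <|
        ((Amv.monomial_mul_monomial _ _ _ _ c.2 d.2).trans (by simp [daggerU])).symm
      map_zero' := Subtype.ext (Amv.monomial_zero _)
      map_add' := fun c d => Subtype.ext (Amv.monomial_add _ _ _ c.2 d.2 (c + d).2) }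
    { toFun := fun n => daggerU hϖ s n.toAdd 1 (by simp)
      map_one' := rfl
      map_mul' := fun n m => Subtype.ext <|
        ((Amv.monomial_mul_monomial _ _ _ _ (by simp) (by simp)).trans (by simp [daggerU])).symm }
    fun _ _ => Commute.all _ _

theorem daggerLaurent_single [IsUltrametricDist E] (n : Fin (f - 1) → ℤ) (c : integerRing E) :
    daggerLaurent p hϖ f s (AddMonoidAlgebra.single n c) = daggerU hϖ s n c.1 c.2 := by
  refine (AddMonoidAlgebra.liftNC_single _ _ _ _).trans (Subtype.ext ?_)
  refine (Amv.monomial_mul_monomial (p := p) _ _ _ _ c.2 (by simp)).trans ?_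
  simp [daggerU]

/-- Modulo `Y_0` and `ϖ / Y_0 ^ s`, every element of `A_{mv,E}^{†,s}` is a Laurent polynomial in the
`U_i`. -/
theorem exists_daggerLaurent [IsUltrametricDist E] (a : AmvDaggerS p hϖ f s) :
    ∃ d b c, a = daggerLaurent p hϖ f s d + daggerX p hϖ f s * b + daggerY p hϖ f s * c := by
  classical
  have hS : {n | ¬ ∀ m, Ord ϖ s 1 m (a.1.fn (n, m))}.Finite :=
    (AmvDaggerS.ordGood hϖ a).eventually 1
  let d : AddMonoidAlgebra (integerRing E) (Fin (f - 1) → ℤ) :=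
    -- Only degree 0 in Y_0 is kept, for the finitely many n whose series is not already of order 1.
    ∑ n ∈ hS.toFinset, AddMonoidAlgebra.single n ⟨a.1.fn (n, 0), a.1.good.le_one _⟩
  have hd : ∀ n, (daggerLaurent p hϖ f s d).1.fn (n, 0) =
      if n ∈ hS.toFinset then a.1.fn (n, 0) else 0 := by
    intro n
    have h : ∀ k c hc, (daggerU (p := p) hϖ (f := f) s k c hc).1.fn (n, 0) =
        if n = k then c else 0 := by
      intro k c hc
      rw [daggerU, Amv.fn_monomial, Pi.single_apply]
      simp
    simp only [d, map_sum, daggerLaurent_single, AddSubmonoidClass.coe_finsetSum, Amv.fn_sum,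
      Finset.sum_apply]
    exact (Finset.sum_congr rfl fun k _ => h k _ _).trans (Finset.sum_ite_eq _ _ _)
  set r := a - daggerLaurent p hϖ f s d with hr
  have hr0 : ∀ g, ‖ϖ‖ < ‖r.1.fn g‖ → 1 ≤ g.2 := by
    rintro ⟨n, m⟩ hg
    have h0 : 0 ≤ m := ((AmvDaggerS.ordGood hϖ r).ord (n, m)).le_of_norm_lt hϖ hg
    by_contra! h1
    obtain rfl : m = 0 := by simp only at h1; omega
    have e : r.1.fn (n, 0) = a.1.fn (n, 0) - (daggerLaurent p hϖ f s d).1.fn (n, 0) := by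
      rw [hr, AddSubgroupClass.coe_sub, Amv.fn_sub, Pi.sub_apply]
    rw [e, hd] at hg
    split_ifs at hg with hn
    · rw [sub_self, norm_zero] at hg
      exact absurd hg (not_lt.2 (norm_nonneg _))
    · rw [sub_zero] at hg
      simp only [Set.Finite.mem_toFinset, Set.mem_ofPred_eq, not_not] at hn
      have := (hn 0).le_of_norm_lt hϖ hg
      norm_num at this
  -- Split the remainder by coefficient size: the part with norms at most that of ϖ is a multiple of
  -- X, and the other part, supported in degrees at least 1, is a multiple of Y_0.
  have h1 : OrdGood ϖ s fun g => if ‖ϖ‖ < ‖r.1.fn g‖ then 0 else r.1.fn g :=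
    (AmvDaggerS.ordGood hϖ r).of_norm_le fun g => by split_ifs <;> simp
  have h2 : OrdGood ϖ s fun g => if ‖ϖ‖ < ‖r.1.fn g‖ then r.1.fn g else 0 :=
    (AmvDaggerS.ordGood hϖ r).of_norm_le fun g => by split_ifs <;> simp
  obtain ⟨b, hb⟩ : daggerX p hϖ f s ∣ h1.toDaggerS p hϖ := by
    rw [daggerX_dvd]
    intro g
    rw [OrdGood.fn_toDaggerS]
    split_ifs with h
    · simp
    · exact not_lt.1 h
  obtain ⟨c, hc⟩ : daggerY p hϖ f s ∣ h2.toDaggerS p hϖ := by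
    refine daggerY_dvd hϖ fun g hg => ?_
    rw [OrdGood.fn_toDaggerS] at hg ⊢
    split_ifs at hg ⊢ with h
    · exact ⟨h, hr0 g h⟩
    · exact absurd rfl hg
  have e : r = h1.toDaggerS p hϖ + h2.toDaggerS p hϖ := by
    apply Subtype.ext
    apply Amv.fn_injective
    ext g
    rw [Subring.coe_add, Amv.fn_add, Pi.add_apply, OrdGood.fn_toDaggerS, OrdGood.fn_toDaggerS]
    split_ifs <;> simp
  exact ⟨d, b, c, by rw [add_assoc, ← hb, ← hc, ← e, hr]; ring⟩

instance isNoetherianRing_AmvDaggerS : IsNoetherianRing (AmvDaggerS p hϖ f s) := by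
  have := isUltrametricDist p E
  have := hϖ.isNoetherianRing_integerRing
  have : IsNoetherianRing (AddMonoidAlgebra (integerRing E) (Fin (f - 1) → ℤ)) :=
    Algebra.FiniteType.isNoetherianRing (integerRing E) _
  exact isNoetherianRing_of_quotient_span_pair (daggerLaurent p hϖ f s) (exists_daggerLaurent hϖ)
    (fun a => eq_zero_of_daggerX_pow_dvd hϖ) (daggerX_exists_sum hϖ)
    (fun a => daggerX_dvd_of_forall hϖ) (daggerY_exists_sum hϖ)

end Noetherian

/-! ### Flatness and faithful flatness of `Amv` -/

section Flatness

variable {p : ℕ} [Fact p.Prime] {E : Type*} [NormedField E] [NormedAlgebra ℚ_[p] E]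
  [FiniteDimensional ℚ_[p] E] {ϖ : E} (hϖ : IsUniformizer ϖ) {f : ℕ} {s : ℕ+}

theorem daggerX_mul_Y₀_pow (s : ℕ+) :
    (daggerX p hϖ f s).1 * (Amv.Y₀ p E f : Amv p E f) ^ (s : ℕ) = Amv.uniformizer p f hϖ := by
  rw [Amv.Y₀_pow, daggerX, Amv.monomial_mul_monomial]
  simp only [Prod.mk_add_mk, add_zero, neg_add_cancel, mul_one]
  rfl

theorem Amv.Y₀_mem_daggerS (s : ℕ+) : (Amv.Y₀ p E f : Amv p E f) ∈ AmvDaggerS p hϖ f s :=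
  (daggerY p hϖ f s).2

theorem Amv.uniformizer_mem_daggerS (s : ℕ+) :
    Amv.uniformizer p f hϖ ∈ AmvDaggerS p hϖ f s := by
  rw [← daggerX_mul_Y₀_pow hϖ s]
  exact mul_mem (daggerX p hϖ f s).2 (pow_mem (Amv.Y₀_mem_daggerS hϖ s) _)

variable (p f) in
/-- The ring `A_{mv,E}^{†,s}[1/Y_0]`, as a subring of `A_{mv,E}`. -/
noncomputable def daggerLoc (s : ℕ+) : Subring (Amv p E f) where
  carrier := {a | ∃ k : ℕ, (Amv.Y₀ p E f : Amv p E f) ^ k * a ∈ AmvDaggerS p hϖ f s}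
  zero_mem' := ⟨0, by simp⟩
  one_mem' := ⟨0, by simp⟩
  neg_mem' := by
    rintro a ⟨k, hk⟩
    exact ⟨k, by simpa using neg_mem hk⟩
  add_mem' := by
    rintro a b ⟨k, hk⟩ ⟨l, hl⟩
    refine ⟨k + l, ?_⟩
    have h := add_mem (mul_mem (pow_mem (Amv.Y₀_mem_daggerS hϖ s) l) hk)
      (mul_mem (pow_mem (Amv.Y₀_mem_daggerS hϖ s) k) hl)
    convert h using 1
    ring
  mul_mem' := by
    rintro a b ⟨k, hk⟩ ⟨l, hl⟩
    refine ⟨k + l, ?_⟩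
    convert mul_mem hk hl using 1
    ring

theorem daggerS_le_daggerLoc (s : ℕ+) : AmvDaggerS p hϖ f s ≤ daggerLoc p hϖ f s :=
  fun a ha => ⟨0, by simpa using ha⟩

theorem daggerLoc_mono : Monotone (daggerLoc p hϖ f) := by
  rintro s t hst a ⟨k, hk⟩
  exact ⟨k, AmvDaggerS_mono p hϖ f hst hk⟩

theorem Y₀_inv_mem_daggerLoc (s : ℕ+) :
    (↑(Amv.Y₀ p E f)⁻¹ : Amv p E f) ∈ daggerLoc p hϖ f s :=
  ⟨1, by rw [pow_one, Units.mul_inv]; exact one_mem _⟩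

theorem mem_AmvDagger_iff {a : Amv p E f} :
    a ∈ AmvDagger p hϖ f ↔ ∃ s, a ∈ daggerLoc p hϖ f s := by
  constructor
  · rintro ⟨k, y, hy, rfl⟩
    obtain ⟨s, hs⟩ := Set.mem_iUnion.1 hy
    exact ⟨s, mul_mem (daggerS_le_daggerLoc hϖ s hs) (pow_mem (Y₀_inv_mem_daggerLoc hϖ s) k)⟩
  · rintro ⟨s, k, hk⟩
    refine ⟨k, _, Set.mem_iUnion.2 ⟨s, hk⟩, ?_⟩
    rw [mul_right_comm, ← mul_pow, Units.mul_inv, one_pow, one_mul]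

/-- If ϖ Y_0 ^ k a lies in S_s, its coefficients are divisible by ϖ, so it equals X c with c in S_s.
Multiplying by Y_0 ^ s and cancelling ϖ gives Y_0 ^ (k + s) a = c. -/
theorem mem_daggerLoc_of_uniformizer_mul {a : Amv p E f}
    (h : Amv.uniformizer p f hϖ * a ∈ daggerLoc p hϖ f s) : a ∈ daggerLoc p hϖ f s := by
  obtain ⟨k, hk⟩ := h
  rw [mul_left_comm] at hk
  obtain ⟨c, hc⟩ : daggerX p hϖ f s ∣ ⟨_, hk⟩ := (daggerX_dvd hϖ).2 fun g => by
    rw [Amv.fn_uniformizer_mul, norm_mul]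
    exact mul_le_of_le_one_right (norm_nonneg _) (Amv.good _ |>.le_one g)
  have hc' := congrArg Subtype.val hc
  simp only [Subring.coe_mul] at hc'
  refine ⟨k + s, ?_⟩
  have : (Amv.Y₀ p E f : Amv p E f) ^ (k + (s : ℕ)) * a = c.1 := by
    apply Amv.uniformizer_mul_cancel hϖ
    rw [← daggerX_mul_Y₀_pow hϖ s] at hc' ⊢
    linear_combination (Amv.Y₀ p E f : Amv p E f) ^ (s : ℕ) * hc'
  rw [this]
  exact c.2

theorem mem_daggerLoc_of_uniformizer_pow_mul {n : ℕ} {a : Amv p E f}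
    (h : Amv.uniformizer p f hϖ ^ n * a ∈ daggerLoc p hϖ f s) : a ∈ daggerLoc p hϖ f s := by
  induction n with
  | zero => simpa using h
  | succ n ih =>
    rw [pow_succ', mul_assoc] at h
    exact ih (mem_daggerLoc_of_uniformizer_mul hϖ h)

/-- Modulo the uniformizer, every element of `A_{mv,E}` comes from `A_{mv,E}^{†,s}[1/Y_0]`. -/
theorem exists_daggerLoc_add_uniformizer_mul (s : ℕ+) (a : Amv p E f) :
    ∃ b ∈ daggerLoc p hϖ f s, ∃ c, a = b + Amv.uniformizer p f hϖ * c := by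
  classical
  obtain ⟨B, hB⟩ := a.good.bddBelow hϖ.norm_pos
  -- Only coefficients of norm at least that of ϖ are kept. Their degrees are bounded below by B, so
  -- multiplying by Y_0 ^ (-B).toNat makes all degrees nonnegative.
  let x : (Fin (f - 1) → ℤ) × ℤ → E := fun g => if ‖ϖ‖ ≤ ‖a.fn g‖ then a.fn g else 0
  have hx : Good (degY _) x := by
    constructor
    · intro g
      simp only [x]
      split_ifs
      · exact a.good.le_one g
      · simp
    · intro ε hε N
      refine (a.good.finite ε hε N).subset ?_
      rintro g ⟨h1, h2⟩
      simp only [x] at h2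
      split_ifs at h2
      · exact ⟨h1, h2⟩
      · rw [norm_zero] at h2
        linarith
  have hy : Good (degY _) fun g => if ‖ϖ‖ ≤ ‖a.fn g‖ then 0 else a.fn g / ϖ := by
    constructor
    · intro g
      split_ifs with h
      · simp
      · rw [norm_div, div_le_one hϖ.norm_pos]
        exact (not_le.1 h).le
    · intro ε hε N
      refine (a.good.finite (ε * ‖ϖ‖) (mul_pos hε hϖ.norm_pos) N).subset ?_
      rintro g ⟨h1, h2⟩
      refine ⟨h1, ?_⟩
      split_ifs at h2
      · rw [norm_zero] at h2
        linarith
      · rwa [norm_div, le_div_iff₀ hϖ.norm_pos] at h2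
  refine ⟨.mk' x hx, ⟨(-B).toNat, (mem_AmvDaggerS hϖ).2 ?_⟩, .mk' _ hy, ?_⟩
  · rw [Amv.Y₀_pow]
    have hne : ∀ g, x g ≠ 0 → ‖ϖ‖ ≤ ‖a.fn g‖ := fun g hg => by
      by_contra h
      exact hg (if_neg h)
    have hfn : ∀ g, (Amv.monomial p (0, ((-B).toNat : ℤ)) 1 (by simp) * Amv.mk' x hx).fn g =
        x (g - (0, ((-B).toNat : ℤ))) := fun g => by
      rw [Amv.fn_monomial_mul, one_mul, Amv.fn_mk']
    constructor
    · intro g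
      rw [hfn]
      by_cases h0 : x (g - (0, ((-B).toNat : ℤ))) = 0
      · rw [h0]
        exact Ord.zero _ _ _
      · refine Ord.of_le (hx.le_one _) ?_
        have h1 : B ≤ g.2 - ((-B).toNat : ℤ) := hB _ (hne _ h0)
        have := Int.self_le_toNat (-B)
        push_cast
        linarith
    · intro K
      -- Outside the finitely many n with a large coefficient in degree below K, every kept term has
      -- degree, hence order, at least K; the nonnegative shift preserves this.
      refine ((a.good.finite _ hϖ.norm_pos K).image Prod.fst).subset fun n hn => ?_
      by_contra H
      refine hn fun m => ?_
      rw [hfn]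
      by_cases h0 : x ((n, m) - (0, ((-B).toNat : ℤ))) = 0
      · rw [h0]
        exact Ord.zero _ _ _
      · refine Ord.of_le (hx.le_one _) ?_
        by_contra! h1
        refine H ⟨_, ⟨?_, hne _ h0⟩, by simp⟩
        change m - ((-B).toNat : ℤ) < K
        have := Int.natCast_nonneg (-B).toNat
        linarith
  · apply Amv.fn_injective
    ext g
    rw [Amv.fn_add, Pi.add_apply, Amv.fn_uniformizer_mul, Amv.fn_mk', Amv.fn_mk']
    simp only [x]
    split_ifs
    · simp
    · rw [zero_add, mul_div_cancel₀ _ hϖ.1]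

instance isNoetherianRing_daggerLoc : IsNoetherianRing (daggerLoc p hϖ f s) := by
  refine isNoetherianRing_of_exists_unit_mul (Subring.inclusion (daggerS_le_daggerLoc hϖ s)) ?_
  rintro ⟨a, k, hk⟩
  let y : (daggerLoc p hϖ f s)ˣ :=
    { val := ⟨_, daggerS_le_daggerLoc hϖ s (Amv.Y₀_mem_daggerS hϖ s)⟩
      inv := ⟨_, Y₀_inv_mem_daggerLoc hϖ s⟩
      val_inv := Subtype.ext (Units.mul_inv _)
      inv_val := Subtype.ext (Units.inv_mul _) }
  exact ⟨y ^ k, ⟨_, hk⟩, Subtype.ext rfl⟩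

instance flat_daggerLoc : Module.Flat (daggerLoc p hϖ f s) (Amv p E f) := by
  let x : daggerLoc p hϖ f s :=
    ⟨_, daggerS_le_daggerLoc hϖ s (Amv.uniformizer_mem_daggerS hϖ s)⟩
  have hx : ∀ (n : ℕ) (a : Amv p E f), x ^ n • a = Amv.uniformizer p f hϖ ^ n * a := fun _ _ => rfl
  have : IsAdicComplete (Ideal.span {x}) (Amv p E f) := by
    refine isAdicComplete_span_singleton x
      (fun a h => Amv.eq_zero_of_uniformizer_pow_dvd hϖ h) fun c => ?_
    obtain ⟨L, hL⟩ := Amv.exists_sum_uniformizer_pow hϖ c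
    exact ⟨L, hL⟩
  refine flat_of_isAdicComplete x (fun n a b h => ?_) fun a => ?_
  · rw [hx] at h
    have hb : b ∈ daggerLoc p hϖ f s := mem_daggerLoc_of_uniformizer_pow_mul hϖ (n := n) (by
      rw [← h]
      exact a.2)
    exact ⟨⟨b, hb⟩, Subtype.ext h⟩
  · obtain ⟨b, hb, c, rfl⟩ := exists_daggerLoc_add_uniformizer_mul hϖ s a
    exact ⟨⟨b, hb⟩, c, rfl⟩

theorem flat_AmvDagger : Module.Flat (AmvDagger p hϖ f) (Amv p E f) :=
  flat_of_directed_subring (daggerLoc_mono hϖ)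
    (fun s _ ha => (mem_AmvDagger_iff hϖ).2 ⟨s, ha⟩) fun _ ha => (mem_AmvDagger_iff hϖ).1 ha

theorem daggerLoc_le_AmvDagger (s : ℕ+) : daggerLoc p hϖ f s ≤ AmvDagger p hϖ f :=
  fun _ ha => (mem_AmvDagger_iff hϖ).2 ⟨s, ha⟩

variable (p f) in
/-- The uniformizer as an element of `A_{mv,E}^†`. -/
noncomputable def AmvDagger.uniformizer : AmvDagger p hϖ f :=
  ⟨_, daggerLoc_le_AmvDagger hϖ 1 (daggerS_le_daggerLoc hϖ 1 (Amv.uniformizer_mem_daggerS hϖ 1))⟩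

theorem AmvDagger.isUnit_one_sub_mul_uniformizer (a : AmvDagger p hϖ f) :
    IsUnit (1 - a * AmvDagger.uniformizer p hϖ f) := by
  obtain ⟨s, k, hk⟩ := (mem_AmvDagger_iff hϖ).1 a.2
  -- With t = Y_0 ^ k a and r = s + k + 1, the identity ϖ = X_r Y_0 ^ r gives a ϖ = X_r Y_0 ^ (s +
  -- 1) t. This is a multiple of X_r in S_r, and X_r is in the Jacobson radical there by
  -- completeness.
  let r : ℕ+ := s + k.succPNat
  let t : AmvDaggerS p hϖ f r := ⟨_, AmvDaggerS_mono p hϖ f (PNat.lt_add_right s _).le hk⟩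
  have hu : IsUnit (daggerX p hϖ f r * -(daggerY p hϖ f r ^ ((s : ℕ) + 1) * t) + 1) :=
    Ideal.mem_jacobson_bot.1 (IsAdicComplete.le_jacobson_bot (Ideal.span {daggerX p hϖ f r})
      (Ideal.mem_span_singleton_self _)) _
  convert hu.map (Subring.inclusion
    ((daggerS_le_daggerLoc hϖ r).trans (daggerLoc_le_AmvDagger hϖ r))) using 1
  apply Subtype.ext
  change 1 - a.1 * Amv.uniformizer p f hϖ = (daggerX p hϖ f r).1 *
    -((Amv.Y₀ p E f : Amv p E f) ^ ((s : ℕ) + 1) * ((Amv.Y₀ p E f : Amv p E f) ^ k * a.1)) + 1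
  have hr : (r : ℕ) = s + 1 + k := by
    simp only [r, PNat.add_coe, Nat.succPNat_coe]
    omega
  rw [← daggerX_mul_Y₀_pow hϖ r, hr]
  ring

theorem faithfullyFlat_AmvDagger : Module.FaithfullyFlat (AmvDagger p hϖ f) (Amv p E f) := by
  have := flat_AmvDagger (p := p) hϖ (f := f)
  refine ⟨fun m hm htop => ?_⟩
  -- Otherwise ϖ is invertible modulo m, and m contains some 1 - y ϖ, which is a unit.
  have hϖm : AmvDagger.uniformizer p hϖ f ∈ m := by
    by_contra h
    obtain ⟨y, i, hi, e⟩ := hm.exists_inv h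
    rw [← sub_eq_iff_eq_add'.2 e.symm] at hi
    exact hm.ne_top (Ideal.eq_top_of_isUnit_mem _ hi
      (AmvDagger.isUnit_one_sub_mul_uniformizer hϖ y))
  have key : ∀ a ∈ (m • ⊤ : Submodule (AmvDagger p hϖ f) (Amv p E f)),
      ∃ b ∈ m, ∃ c, a = b.1 + Amv.uniformizer p f hϖ * c := by
    intro a ha
    induction ha using Submodule.smul_induction_on' with
    | smul r hr a ha =>
      obtain ⟨b, hb, c, rfl⟩ := exists_daggerLoc_add_uniformizer_mul hϖ 1 a
      refine ⟨r * ⟨b, daggerLoc_le_AmvDagger hϖ 1 hb⟩, m.mul_mem_right _ hr, r.1 * c, ?_⟩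
      change r.1 * _ = r.1 * b + _
      ring
    | add a _ a' _ h h' =>
      obtain ⟨b, hb, c, rfl⟩ := h
      obtain ⟨b', hb', c', rfl⟩ := h'
      exact ⟨b + b', add_mem hb hb', c + c', by rw [Subring.coe_add]; ring⟩
  obtain ⟨b, hb, c, hc⟩ := key 1 (by rw [htop]; trivial)
  -- Here ϖ c = 1 - b lies in `AmvDagger`, and saturation recovers c; then 1 = b + ϖ c lies in m, a
  -- contradiction.
  have hcm : c ∈ AmvDagger p hϖ f := by
    obtain ⟨s, hs⟩ := (mem_AmvDagger_iff hϖ).1 (1 - b).2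
    refine daggerLoc_le_AmvDagger hϖ s (mem_daggerLoc_of_uniformizer_mul hϖ ?_)
    convert hs using 1
    exact (sub_eq_iff_eq_add'.2 hc).symm
  refine hm.ne_top ((Ideal.eq_top_iff_one _).2 ?_)
  have e : (1 : AmvDagger p hϖ f) = b + AmvDagger.uniformizer p hϖ f * ⟨c, hcm⟩ := Subtype.ext hc
  rw [e]
  exact add_mem hb (m.mul_mem_right _ hϖm)

theorem AmvDaggerInf_le_AmvDagger : AmvDaggerInf p hϖ f ≤ AmvDagger p hϖ f :=
  fun a ha => ⟨0, a, ha, by simp⟩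

theorem flat_AmvDaggerInf : Module.Flat (AmvDaggerInf p hϖ f) (Amv p E f) := by
  let : Algebra (AmvDaggerInf p hϖ f) (AmvDagger p hϖ f) :=
    (Subring.inclusion (AmvDaggerInf_le_AmvDagger hϖ)).toAlgebra
  have : IsScalarTower (AmvDaggerInf p hϖ f) (AmvDagger p hϖ f) (Amv p E f) :=
    IsScalarTower.of_algebraMap_eq' rfl
  let y : AmvDaggerInf p hϖ f := ⟨_, Amv.Y₀_mem p hϖ f⟩
  have hinv : (↑(Amv.Y₀ p E f)⁻¹ : Amv p E f) ∈ AmvDagger p hϖ f := ⟨1, 1, one_mem _, by simp⟩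
  have hy : IsUnit (algebraMap (AmvDaggerInf p hϖ f) (AmvDagger p hϖ f) y) :=
    IsUnit.of_mul_eq_one ⟨_, hinv⟩ (Subtype.ext (Units.mul_inv _))
  -- Inverting Y_0 is a localization, hence flat, and flatness composes along the tower.
  have : IsLocalization (Submonoid.powers y) (AmvDagger p hϖ f) := by
    refine (isLocalization_iff _ _).2 ⟨?_, ?_, ?_⟩
    · rintro ⟨_, k, rfl⟩
      rw [map_pow]
      exact hy.pow k
    · rintro ⟨_, k, a, ha, rfl⟩
      refine ⟨(⟨a, ha⟩, ⟨y ^ k, k, rfl⟩), Subtype.ext ?_⟩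
      change a * _ ^ k * (Amv.Y₀ p E f : Amv p E f) ^ k = a
      rw [mul_assoc, ← mul_pow, Units.inv_mul, one_pow, mul_one]
    · intro a b h
      exact ⟨1, by rw [Subring.inclusion_injective _ h]⟩
  have := IsLocalization.flat (AmvDagger p hϖ f) (Submonoid.powers y)
  have := flat_AmvDagger (p := p) hϖ (f := f)
  exact Module.Flat.trans (AmvDaggerInf p hϖ f) (AmvDagger p hϖ f) (Amv p E f)

end Flatness

end MvPhiGamma

theorem mainTheorem7 (p : ℕ) [Fact p.Prime]
    (K : Type*) [Field K] [Algebra ℚ_[p] K] [FiniteDimensional ℚ_[p] K]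
    (hK : Algebra.FormallyUnramified (PadicInt.subring p)
      (integralClosure (PadicInt.subring p) K))
    (E : Type*) [NormedField E] [NormedAlgebra ℚ_[p] E] [FiniteDimensional ℚ_[p] E]
    (σ₀ : K →ₐ[ℚ_[p]] E) (ϖ : E) (hϖ : MvPhiGamma.IsUniformizer ϖ)
    (f : ℕ) (hf : f = Module.finrank ℚ_[p] K) :
    Module.Flat (MvPhiGamma.AmvDaggerInf p hϖ f) (MvPhiGamma.Amv p E f) ∧
      Module.FaithfullyFlat (MvPhiGamma.AmvDagger p hϖ f) (MvPhiGamma.Amv p E f) := by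
  exact ⟨MvPhiGamma.flat_AmvDaggerInf hϖ, MvPhiGamma.faithfullyFlat_AmvDagger hϖ⟩
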